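/- **Setting.** Let $d\ge 0$, $K=2$. In each round $t=1,2,\dots$ the agent sees feature vectors $\mathcal X_t=(X_{t,1},X_{t,2})\in(\mathbb R^d)^2$, drawn i.i.d. over $t$ from a density $p$ with respect to Lebesgue measure (and independently of everything that happened before round $t$), and plays an arm $a_t\in\{1,2\}$. The reward of arm $i$ is $Y_{t,i}=\mu(X_{t,i}^\top\beta^*)+\epsilon_{t,i}$, and only $Y_t=Y_{t,a_t}$ is observed. Conditionally on the past and on $\mathcal X_t$ (and the coin used to break ties in round $t$), $\epsilon_{t,i}$ has mean zero and $\mathbb E[e^{\alpha\epsilon_{t,i}}\mid\cdot]\le e^{\alpha^2\sigma^2/2}$ for all $\alpha\in\mathbb R$, where $\sigma>0$. Let $S_0=\{j:\beta^*_j\ne0\}$, $s_0=|S_0|$, $\Sigma=\frac12\mathbb E[X_{t,1}X_{t,1}^\top+X_{t,2}X_{t,2}^\top]$. **Assumptions**, with constants $x_{\max},b,\kappa_0,\phi_0>0$ and $\kappa_1,\nu<\infty$: (1) $\|X_{t,i}\|_2\le x_{\max}$ almost surely and $\|\beta^*\|_2\le b$; (2) $\mu$ is differentiable with $\kappa_0\le\dot\mu(z)\le\kappa_1$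 for all $z\in\mathbb R$; (3) $\phi_0^2\|\beta_{S_0}\|_1^2\le s_0\,\beta^\top\Sigma\beta$ for all $\beta\in\mathbb R^d$ with $\|\beta_{S_0^c}\|_1\le3\|\beta_{S_0}\|_1$; (4) $p(-\mathbf x)\le\nu\,p(\mathbf x)$ for all $\mathbf x\in(\mathbb R^d)^2$. **Algorithm** (SA Lasso Bandit with input $\lambda_0$; it does not know $s_0$). In round $t$ play an arm $a_t$ maximizing $X_{t,i}^\top\hat\beta_t$, a tie being broken by a fair coin independent of everything before it and of $\mathcal X_t$. With $X_t=X_{t,a_t}$, $\lambda_t=\lambda_0\sqrt{(4\log t+2\log d)/t}$ and $\dot m=\mu$, let $\hat\beta_{t+1}$ be a (measurably chosen) minimizer over $\beta\in\mathbb R^d$ of $$-\frac1t\sum_{j=1}^t\big[Y_jX_j^\top\beta-m(X_j^\top\beta)\big]+\lambda_t\|\beta\|_1 ;$$ $\hat\beta_1$ is an arbitrary fixed vector. Its expected regret is $\mathcal R(T)=\sum_{t=1}^T\mathbb E\big[\max_i\mu(X_{t,i}^\top\beta^*)-\mu(X_{t,a_t}^\top\beta^*)\big]$. **Theorem 1.**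 Let $\lambda_0=2\sigma x_{\max}$ and $C_0(s_0)=\min\big(\tfrac12,\tfrac{\phi_0^2}{256\,s_0\nu x_{\max}^2}\big)$. Then the expectations in $\mathcal R(T)$ exist, and for every $T\ge1$ $$\mathcal R(T)\le4\kappa_1+\frac{4\kappa_1x_{\max}b\,(\log(2d^2)+1)}{C_0(s_0)^2}+\frac{32\,\kappa_1\nu\sigma x_{\max}^2s_0\sqrt{T\log(dT)}}{\kappa_0\phi_0^2}.$$ If $x_{\max}\le1$, this also holds with $x_{\max}$ in place of $x_{\max}^2$ in the last term. Moreover $\mathcal R(T)=O(s_0\sqrt{T\log(dT)})$: there is a constant $C$ depending only on $\kappa_0,\kappa_1,\nu,\sigma,x_{\max},\phi_0,b$ such that $\mathcal R(T)\le C\,s_0\sqrt{T\log(dT)}$ whenever $T\ge1$ and $dT\ge2$. (When $\beta^*=0$, that is $s_0=0$, the regret is $0$ and the middle term may be dropped.) -/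

import Mathlib

open MeasureTheory ProbabilityTheory
open scoped NNReal ENNReal

noncomputable section

/-- Feature and parameter space `ℝ^d` with its Euclidean norm. -/
abbrev Vec (d : ℕ) : Type := EuclideanSpace ℝ (Fin d)

/-- The feature vectors of the two arms. -/
abbrev Contexts (d : ℕ) : Type := Fin 2 → Vec d

/-- `‖β_S‖₁`, the ℓ¹-norm of the restriction of `β` to the coordinates in `S`. -/
def l1On {d : ℕ} (S : Finset (Fin d)) (β : Vec d) : ℝ := ∑ j ∈ S, |β j|

/-- `‖β‖₁`. -/
def l1Norm {d : ℕ} (β : Vec d) : ℝ := l1On Finset.univ β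

/-- The active set `S₀ = {j : β_j ≠ 0}`. -/
def activeSet {d : ℕ} (β : Vec d) : Finset (Fin d) := {j | β j ≠ 0}

/-- The sparsity index `s₀ = |S₀|`. -/
def sparsity {d : ℕ} (β : Vec d) : ℕ := (activeSet β).card

/-- The theoretical Gram matrix `Σ = (1/K) E[𝐗ᵀ𝐗]` (`K = 2`) of a law of the context;
its `(j,k)` entry is `(1/2) ∑_i E[X_{i,j} X_{i,k}]`. -/
def gramMatrix {d : ℕ} (law : Measure (Contexts d)) : Matrix (Fin d) (Fin d) ℝ :=
  Matrix.of fun j k => (1 / 2 : ℝ) * ∑ i : Fin 2, ∫ x, x i j * x i k ∂law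

/-- Compatibility condition for the matrix `M` and the index set `S` with constant `φ²`. -/
def CompatibilityCondition {d : ℕ} (M : Matrix (Fin d) (Fin d) ℝ) (S : Finset (Fin d))
    (φ : ℝ) : Prop :=
  ∀ β : Vec d, l1On Sᶜ β ≤ 3 * l1On S β →
    φ ^ 2 * l1On S β ^ 2 ≤ (S.card : ℝ) * (β.ofLp ⬝ᵥ M.mulVec β.ofLp)

/-! ### The algorithm -/

/-- `ℓ_n(β) + lam ‖β‖₁` for the data `D = ((X_1,Y_1),…,(X_n,Y_n))`, where
`ℓ_n(β) = -(1/n) ∑_j [Y_j X_jᵀβ - m(X_jᵀβ)]`. -/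
def lassoObjective {d n : ℕ} (m : ℝ → ℝ) (lam : ℝ) (D : Fin n → Vec d × ℝ) (β : Vec d) : ℝ :=
  -(1 / (n : ℝ)) * ∑ j, ((D j).2 * inner ℝ (D j).1 β - m (inner ℝ (D j).1 β)) + lam * l1Norm β

/-- The regularization parameter `λ_n = λ₀ √((4 log n + 2 log d) / n)`. -/
def regParam (lam0 : ℝ) (d n : ℕ) : ℝ :=
  lam0 * √((4 * Real.log n + 2 * Real.log d) / n)

/-- `est n D` is the parameter estimate computed from the first `n` observations `D`. For `n ≥ 1`
it is a (measurably selected) minimizer of the Lasso objective with parameter `λ_n`; the initial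
estimate `est 0` is arbitrary. -/
structure IsLassoEstimator {d : ℕ} (m : ℝ → ℝ) (lam0 : ℝ)
    (est : (n : ℕ) → (Fin n → Vec d × ℝ) → Vec d) : Prop where
  measurable : ∀ n, Measurable (est n)
  isMin : ∀ n, 1 ≤ n → ∀ (D : Fin n → Vec d × ℝ) (β : Vec d),
    lassoObjective m (regParam lam0 d n) D (est n D) ≤ lassoObjective m (regParam lam0 d n) D β

/-- The arm maximizing `x_iᵀβ`; in the case of a tie, the arm `u`. -/
def greedyArm {d : ℕ} (β : Vec d) (x : Contexts d) (u : Fin 2) : Fin 2 :=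
  if inner ℝ (x 0) β < inner ℝ (x 1) β then 1
  else if inner ℝ (x 1) β < inner ℝ (x 0) β then 0
  else u

/-! ### The bandit problem -/

/-- The data of a two-armed generalized linear contextual bandit, together with the coins used to
break ties. Rounds are indexed by `t = 0, 1, 2, …`, so that `T` rounds are `t < T`. -/
structure GLMBandit (d : ℕ) (Ω : Type*) where
  /-- The inverse link function `μ`. -/
  link : ℝ → ℝ
  /-- The normalization function `m` of the likelihood, an antiderivative of `μ`. -/
  cumulant : ℝ → ℝ
  /-- The unknown parameter `β*`. -/
  param : Vec d
  /-- The joint density of the feature vectors of one round. -/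
  density : Contexts d → ℝ≥0
  /-- The feature vectors `X_{t,i}`. -/
  ctx : ℕ → Ω → Contexts d
  /-- The noise `ε_{t,i}`. -/
  noise : ℕ → Fin 2 → Ω → ℝ
  /-- The tie-breaking coins. -/
  coin : ℕ → Ω → Fin 2

namespace GLMBandit

variable {d : ℕ} {Ω : Type*}

/-- The law of the feature vectors of one round. -/
def law (B : GLMBandit d Ω) : Measure (Contexts d) :=
  (volume : Measure (Contexts d)).withDensity fun x => (B.density x : ℝ≥0∞)

/-- The reward `Y_{t,i} = μ(X_{t,i}ᵀβ*) + ε_{t,i}`. -/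
def reward (B : GLMBandit d Ω) (t : ℕ) (i : Fin 2) (ω : Ω) : ℝ :=
  B.link (inner ℝ (B.ctx t ω i) B.param) + B.noise t i ω

/-- All that is random strictly before round `t`. -/
def past (B : GLMBandit d Ω) (t : ℕ) : MeasurableSpace Ω :=
  ⨆ s : Fin t, (MeasurableSpace.comap (B.ctx s) inferInstance ⊔
    MeasurableSpace.comap (B.coin s) inferInstance ⊔
    ⨆ i : Fin 2, MeasurableSpace.comap (B.noise s i) inferInstance)

/-- All that is random strictly before round `t`, and the feature vectors of round `t`. -/
def pastCtx (B : GLMBandit d Ω) (t : ℕ) : MeasurableSpace Ω :=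
  B.past t ⊔ MeasurableSpace.comap (B.ctx t) inferInstance

/-- All that is random before the reward of round `t` is drawn. -/
def preReward (B : GLMBandit d Ω) (t : ℕ) : MeasurableSpace Ω :=
  B.pastCtx t ⊔ MeasurableSpace.comap (B.coin t) inferInstance

/-- The observations `(X_{s,a_s}, Y_{s,a_s})`, `s < n`, of the policy that in every round plays the
greedy arm for the current estimate. -/
def history (B : GLMBandit d Ω) (est : (n : ℕ) → (Fin n → Vec d × ℝ) → Vec d) (ω : Ω) :
    (n : ℕ) → Fin n → Vec d × ℝ
  | 0 => Fin.elim0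
  | n + 1 =>
    Fin.snoc (α := fun _ => Vec d × ℝ) (history B est ω n)
      (B.ctx n ω (greedyArm (est n (history B est ω n)) (B.ctx n ω) (B.coin n ω)),
        B.reward n (greedyArm (est n (history B est ω n)) (B.ctx n ω) (B.coin n ω)) ω)

/-- The arm `a_t` played in round `t`. -/
def arm (B : GLMBandit d Ω) (est : (n : ℕ) → (Fin n → Vec d × ℝ) → Vec d) (t : ℕ) (ω : Ω) :
    Fin 2 :=
  greedyArm (est t (B.history est ω t)) (B.ctx t ω) (B.coin t ω)

/-- `max_i μ(X_{t,i}ᵀβ*) - μ(X_{t,a_t}ᵀβ*)`. -/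
def instantRegret (B : GLMBandit d Ω) (est : (n : ℕ) → (Fin n → Vec d × ℝ) → Vec d) (t : ℕ)
    (ω : Ω) : ℝ :=
  max (B.link (inner ℝ (B.ctx t ω 0) B.param)) (B.link (inner ℝ (B.ctx t ω 1) B.param)) -
    B.link (inner ℝ (B.ctx t ω (B.arm est t ω)) B.param)

/-- The expected cumulative regret over `T` rounds. -/
def regret [MeasurableSpace Ω] (B : GLMBandit d Ω) (P : Measure Ω)
    (est : (n : ℕ) → (Fin n → Vec d × ℝ) → Vec d) (T : ℕ) : ℝ :=
  ∑ t ∈ Finset.range T, ∫ ω, B.instantRegret est t ω ∂P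

/-- The stochastic model: the feature vectors are drawn i.i.d. over the rounds from the given
density with respect to Lebesgue measure, the coins are fair and independent of everything that
precedes them, and, conditionally on everything that precedes it (the current features included),
each noise variable has mean zero and is sub-Gaussian with parameter `σ`. -/
structure IsModel [MeasurableSpace Ω] (B : GLMBandit d Ω) (P : Measure Ω) (σ : ℝ) : Prop where
  measurable_density : Measurable B.density
  measurable_ctx : ∀ t, Measurable (B.ctx t)
  measurable_noise : ∀ t i, Measurable (B.noise t i)
  measurable_coin : ∀ t, Measurable (B.coin t)
  hasDerivAt_cumulant : ∀ z, HasDerivAt B.cumulant (B.link z) z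
  ctx_law : ∀ t, P.map (B.ctx t) = B.law
  ctx_indep : ∀ t, Indep (MeasurableSpace.comap (B.ctx t) inferInstance) (B.past t) P
  coin_fair : ∀ t i, P (B.coin t ⁻¹' {i}) = 1 / 2
  coin_indep : ∀ t, Indep (MeasurableSpace.comap (B.coin t) inferInstance) (B.pastCtx t) P
  noise_mean : ∀ t i, P[B.noise t i | B.preReward t] =ᵐ[P] 0
  noise_integrable_exp : ∀ t i (α : ℝ), Integrable (fun ω => Real.exp (α * B.noise t i ω)) P
  noise_subGaussian : ∀ t i (α : ℝ),
    P[fun ω => Real.exp (α * B.noise t i ω) | B.preReward t] ≤ᵐ[P]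
      fun _ => Real.exp (α ^ 2 * σ ^ 2 / 2)

/-- The assumptions on features, parameter, link function, Gram matrix and context density. -/
structure Regular [MeasurableSpace Ω] (B : GLMBandit d Ω) (P : Measure Ω)
    (xmax b κ₀ κ₁ φ₀ ν : ℝ) : Prop where
  /-- bounded features -/
  norm_ctx_le : ∀ t, ∀ᵐ ω ∂P, ∀ i, ‖B.ctx t ω i‖ ≤ xmax
  /-- bounded parameter -/
  norm_param_le : ‖B.param‖ ≤ b
  /-- differentiable link function -/
  differentiable_link : Differentiable ℝ B.link
  /-- derivative of the link function between `κ₀` and `κ₁` -/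
  deriv_link : ∀ z, κ₀ ≤ deriv B.link z ∧ deriv B.link z ≤ κ₁
  /-- compatibility condition for the theoretical Gram matrix and the active set -/
  compatibility : CompatibilityCondition (gramMatrix B.law) (activeSet B.param) φ₀
  /-- relaxed symmetry of the context density -/
  relaxed_symmetry : ∀ x, (B.density (-x) : ℝ) ≤ ν * B.density x

end GLMBandit

/-- `C₀(s) = min(1/2, φ₀² / (256 s ν x_max²))`. -/
def C0 (φ₀ ν xmax : ℝ) (s : ℕ) : ℝ := min (1 / 2) (φ₀ ^ 2 / (256 * s * ν * xmax ^ 2))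

end

/-! A greedy rule needs no explicit exploration if the features it selects are as informative as a
random choice of arm. Relaxed symmetry guarantees this. For fixed `β`, the contexts `x` and `-x`
lead to opposite greedy arms, and in a tie the coin averages the two arms. So the second moments of
the greedy feature at `x` and at `-x` add up to those of both arms. Reflection changes the density
by a factor of at most `ν`, so `Σ ≤ ν · greedyGram β` as quadratic forms, whatever `β` is
(`gramMatrix_le_greedyGram`). Hence the average of the conditional Gram matrices along the run
always dominates `Σ / ν`, however the estimates behave.

The rest is Lasso theory with martingale concentration. The noise averages and the entries of the
empirical Gram matrix minus its compensator are averages of conditionally sub-Gaussian increments.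
Outside a small event they are at most `λ_n / 2` and `φ₀² / (64 s₀ ν)`, respectively. On the good
event the basic inequality places the error `δ` in the compatibility cone, the Gram perturbation
costs a quarter of `δᵀΣδ`, and `δᵀΣδ ≤ 4 ν² λ_n² s₀ / (κ₀² φ₀²)` (`quadratic_le_of_compatibility`,
`measureReal_predError_gt_le`).

Prediction error controls regret directly. The loss of a round is at most `κ₁ |⟨X₀ - X₁, δ⟩|`, and
`δ` depends only on the past, which is independent of the current features. The conditional second
moment of the inner product is therefore at most `4 δᵀΣδ`, and a round with `δᵀΣδ ≤ q²` costs at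
most `2 κ₁ q` on average (`integral_instantRegret_le`). Summing over rounds, `λ_t ~ t^(-1/2)`
produces `√T`, and the bad events produce the middle term. That term grows like `s₀²`. For the order
of growth it is absorbed when `√T` exceeds `s₀ √(log (dT))`, and otherwise the trivial bound linear
in `T` suffices. -/

/-! ### Conditioning through weights -/

/-- Independence lemma: a variable independent of `m` may be integrated out first. -/
theorem lintegral_comp_of_indep {Ω E F : Type*} {m mΩ : MeasurableSpace Ω} [MeasurableSpace E]
    [MeasurableSpace F] {P : Measure Ω} [IsProbabilityMeasure P]
    (hm : m ≤ mΩ) {X : Ω → E} {g : Ω → F} (hX : Measurable X)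
    (h : Indep (MeasurableSpace.comap X inferInstance) m P) (hg : Measurable[m] g)
    {f : F → E → ℝ≥0∞} (hf : Measurable (Function.uncurry f)) :
    ∫⁻ ω, f (g ω) (X ω) ∂P = ∫⁻ ω, ∫⁻ x, f (g ω) x ∂(P.map X) ∂P := by
  have hg' : Measurable g := hg.mono hm le_rfl
  have hi : IndepFun g X P := by
    rw [IndepFun_iff_Indep]
    exact indep_of_indep_of_le_left h.symm hg.comap_le
  have := (indepFun_iff_map_prod_eq_prod_map_map hg'.aemeasurable hX.aemeasurable).1 hi
  have : IsProbabilityMeasure (P.map X) := Measure.isProbabilityMeasure_map hX.aemeasurable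
  have : IsProbabilityMeasure (P.map g) := Measure.isProbabilityMeasure_map hg'.aemeasurable
  calc ∫⁻ ω, f (g ω) (X ω) ∂P
      = ∫⁻ z, Function.uncurry f z ∂(P.map fun ω => (g ω, X ω)) := by
        rw [lintegral_map hf (hg'.prodMk hX)]; rfl
    _ = ∫⁻ y, ∫⁻ x, f y x ∂(P.map X) ∂(P.map g) := by
        rw [‹P.map _ = _›, lintegral_prod _ hf.aemeasurable]; rfl
    _ = _ := by
        exact lintegral_map hf.lintegral_prod_right' hg'

/-- The measures `f · P` and `c · P` are compared on `m`-measurable sets, so the inequality passes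
to every `m`-measurable nonnegative weight. Bounds tested against such weights stand in for
conditional bounds from here on. -/
theorem lintegral_mul_le_of_condExp_le {Ω : Type*} {m mΩ : MeasurableSpace Ω} {P : Measure Ω}
    [IsProbabilityMeasure P] (hm : m ≤ mΩ) {f : Ω → ℝ} (hf0 : 0 ≤ f) (hfi : Integrable f P)
    {c : ℝ} (hc : 0 ≤ c) (h : P[f | m] ≤ᵐ[P] fun _ => c) {W : Ω → ℝ≥0∞} (hW : Measurable[m] W) :
    ∫⁻ ω, W ω * ENNReal.ofReal (f ω) ∂P ≤ ENNReal.ofReal c * ∫⁻ ω, W ω ∂P := by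
  have hle : (P.withDensity fun ω => ENNReal.ofReal (f ω)).trim hm ≤
      (ENNReal.ofReal c • P).trim hm := by
    rw [Measure.le_iff]
    intro s hs
    rw [trim_measurableSet_eq hm hs, trim_measurableSet_eq hm hs, withDensity_apply _ (hm s hs),
      ← ofReal_integral_eq_lintegral_ofReal hfi.integrableOn (ae_of_all _ hf0),
      ← setIntegral_condExp hm hfi hs]
    calc ENNReal.ofReal (∫ ω in s, (P[f | m]) ω ∂P)
        ≤ ENNReal.ofReal (∫ _ in s, c ∂P) := by
          apply ENNReal.ofReal_le_ofReal
          exact setIntegral_mono_ae integrable_condExp.integrableOn integrableOn_const h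
      _ = (ENNReal.ofReal c • P) s := by
          rw [setIntegral_const, smul_eq_mul, mul_comm, ENNReal.ofReal_mul hc, ofReal_measureReal]
          rfl
  have hfm : AEMeasurable (fun ω => ENNReal.ofReal (f ω)) P :=
    hfi.aestronglyMeasurable.aemeasurable.ennreal_ofReal
  calc ∫⁻ ω, W ω * ENNReal.ofReal (f ω) ∂P
      = ∫⁻ ω, W ω ∂(P.withDensity fun ω => ENNReal.ofReal (f ω)) := by
        rw [lintegral_withDensity_eq_lintegral_mul₀ hfm (hW.mono hm le_rfl).aemeasurable]
        simp only [Pi.mul_apply, mul_comm]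
    _ = ∫⁻ ω, W ω ∂((P.withDensity fun ω => ENNReal.ofReal (f ω)).trim hm) :=
        (lintegral_trim hm hW).symm
    _ ≤ ∫⁻ ω, W ω ∂((ENNReal.ofReal c • P).trim hm) := lintegral_mono' hle le_rfl
    _ = _ := by rw [lintegral_trim hm hW, lintegral_smul_measure, smul_eq_mul]

/-- A conditionally sub-Gaussian variable times an `m`-measurable coefficient. -/
theorem lintegral_mul_exp_mul_le_of_condExp_le {Ω : Type*} {m mΩ : MeasurableSpace Ω}
    {P : Measure Ω} [IsProbabilityMeasure P] (hm : m ≤ mΩ) {X : Ω → ℝ} {σ : ℝ}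
    (hX : Measurable X)
    (hint : ∀ α : ℝ, Integrable (fun ω => Real.exp (α * X ω)) P)
    (h : ∀ α : ℝ, P[fun ω => Real.exp (α * X ω) | m] ≤ᵐ[P] fun _ => Real.exp (α ^ 2 * σ ^ 2 / 2))
    {A : Ω → ℝ} (hA : Measurable[m] A) {W : Ω → ℝ≥0∞} (hW : Measurable[m] W) :
    ∫⁻ ω, W ω * ENNReal.ofReal (Real.exp (A ω * X ω)) ∂P ≤
      ∫⁻ ω, W ω * ENNReal.ofReal (Real.exp (A ω ^ 2 * σ ^ 2 / 2)) ∂P := by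
  -- Dividing by the target factor makes the right side independent of `A`. For a simple coefficient
  -- the hypothesis applies on each level set, and Fatou's lemma then reaches general `A` without
  -- any domination.
  have key : ∀ V : Ω → ℝ≥0∞, Measurable[m] V →
      ∫⁻ ω, V ω * ENNReal.ofReal (Real.exp (A ω * X ω - A ω ^ 2 * σ ^ 2 / 2)) ∂P ≤
        ∫⁻ ω, V ω ∂P := by
    intro V hV
    have hAs : StronglyMeasurable[m] A := hA.stronglyMeasurable
    have hstep : ∀ k, ∫⁻ ω, V ω * ENNReal.ofReal
        (Real.exp (hAs.approx k ω * X ω - hAs.approx k ω ^ 2 * σ ^ 2 / 2)) ∂P ≤ ∫⁻ ω, V ω ∂P := by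
      intro k
      have hSmeas : Measurable[m] (hAs.approx k) := @SimpleFunc.measurable _ _ m _ _
      have hfin : (Set.range (hAs.approx k)).Finite := @SimpleFunc.finite_range _ _ m _
      generalize (hAs.approx k : Ω → ℝ) = S at hSmeas hfin
      have hSm : ∀ a : ℝ, MeasurableSet[m] (S ⁻¹' {a}) := fun a =>
        hSmeas (measurableSet_singleton a)
      have hsum : ∀ Y : Ω → ℝ≥0∞, ∀ ω,
          Y ω = ∑ a ∈ hfin.toFinset, (S ⁻¹' {a}).indicator Y ω := by
        intro Y ω
        rw [Finset.sum_eq_single (S ω)]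
        · simp
        · intro a _ ha
          simp [Set.indicator_of_notMem, Ne.symm ha]
        · intro hn
          simp at hn
      have hX' : ∀ a : ℝ, Measurable fun ω => ENNReal.ofReal (Real.exp (a * X ω)) := fun a => by
        fun_prop
      calc ∫⁻ ω, V ω * ENNReal.ofReal (Real.exp (S ω * X ω - S ω ^ 2 * σ ^ 2 / 2)) ∂P
          = ∫⁻ ω, ∑ a ∈ hfin.toFinset, ENNReal.ofReal (Real.exp (-(a ^ 2 * σ ^ 2 / 2))) *
              ((S ⁻¹' {a}).indicator V ω * ENNReal.ofReal (Real.exp (a * X ω))) ∂P := by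
            refine lintegral_congr fun ω => ?_
            rw [hsum (fun ω => V ω * ENNReal.ofReal
              (Real.exp (S ω * X ω - S ω ^ 2 * σ ^ 2 / 2))) ω]
            refine Finset.sum_congr rfl fun a _ => ?_
            by_cases hω : ω ∈ S ⁻¹' {a}
            · have : S ω = a := hω
              simp only [Set.indicator_of_mem hω, this]
              rw [sub_eq_neg_add, Real.exp_add, ENNReal.ofReal_mul (Real.exp_pos _).le]
              ring
            · simp [Set.indicator_of_notMem hω]
        _ = ∑ a ∈ hfin.toFinset, ENNReal.ofReal (Real.exp (-(a ^ 2 * σ ^ 2 / 2))) *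
              ∫⁻ ω, (S ⁻¹' {a}).indicator V ω * ENNReal.ofReal (Real.exp (a * X ω)) ∂P := by
            rw [lintegral_finsetSum]
            · refine Finset.sum_congr rfl fun a _ => ?_
              rw [lintegral_const_mul]
              exact ((hV.indicator (hSm a)).mono hm le_rfl).mul (hX' a)
            · intro a _
              exact (((hV.indicator (hSm a)).mono hm le_rfl).mul (hX' a)).const_mul _
        _ ≤ ∑ a ∈ hfin.toFinset, ∫⁻ ω, (S ⁻¹' {a}).indicator V ω ∂P := by
            refine Finset.sum_le_sum fun a _ => ?_
            refine (mul_le_mul_right (lintegral_mul_le_of_condExp_le hm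
              (fun ω => (Real.exp_pos _).le) (hint a) (Real.exp_pos _).le (h a)
              (hV.indicator (hSm a))) _).trans_eq ?_
            rw [← mul_assoc, ← ENNReal.ofReal_mul (Real.exp_pos _).le, ← Real.exp_add]
            simp
        _ = ∫⁻ ω, V ω ∂P := by
            rw [← lintegral_finsetSum _ fun a _ => (hV.indicator (hSm a)).mono hm le_rfl]
            exact lintegral_congr fun ω => (hsum V ω).symm
    have hVm : Measurable V := hV.mono hm le_rfl
    calc ∫⁻ ω, V ω * ENNReal.ofReal (Real.exp (A ω * X ω - A ω ^ 2 * σ ^ 2 / 2)) ∂P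
        = ∫⁻ ω, Filter.liminf (fun k => V ω * ENNReal.ofReal (Real.exp
            (hAs.approx k ω * X ω - hAs.approx k ω ^ 2 * σ ^ 2 / 2))) Filter.atTop ∂P := by
          refine lintegral_congr fun ω => (Filter.Tendsto.liminf_eq ?_).symm
          have ht := hAs.tendsto_approx ω
          refine ENNReal.Tendsto.const_mul ?_ (Or.inl (by simp [Real.exp_pos]))
          refine ENNReal.tendsto_ofReal ((Real.continuous_exp.tendsto _).comp ?_)
          exact (ht.mul_const _).sub (((ht.pow 2).mul_const _).div_const _)
      _ ≤ Filter.liminf (fun k => ∫⁻ ω, V ω * ENNReal.ofReal (Real.exp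
            (hAs.approx k ω * X ω - hAs.approx k ω ^ 2 * σ ^ 2 / 2)) ∂P) Filter.atTop := by
          refine lintegral_liminf_le fun k => ?_
          have : Measurable (hAs.approx k) := (@SimpleFunc.measurable _ _ m _ (hAs.approx k)).mono hm le_rfl
          fun_prop
      _ ≤ Filter.liminf (fun _ : ℕ => ∫⁻ ω, V ω ∂P) Filter.atTop :=
          Filter.liminf_le_liminf (Filter.Eventually.of_forall hstep)
      _ = ∫⁻ ω, V ω ∂P := by simp
  refine le_trans (le_of_eq ?_)
    (key (fun ω => W ω * ENNReal.ofReal (Real.exp (A ω ^ 2 * σ ^ 2 / 2))) ?_)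
  · refine lintegral_congr fun ω => ?_
    rw [mul_assoc, ← ENNReal.ofReal_mul (Real.exp_pos _).le, ← Real.exp_add]
    simp
  · exact hW.mul ((Real.measurable_exp.comp
      (((hA.pow_const 2).mul_const _).div_const _)).ennreal_ofReal)

/-- The exponential of the first `n` increments is itself an admissible weight for increment `n`, so
the one-step bounds multiply. -/
theorem lintegral_exp_sum_le {Ω : Type*} {mΩ : MeasurableSpace Ω} {P : Measure Ω}
    [IsProbabilityMeasure P] {F : ℕ → MeasurableSpace Ω} {Z : ℕ → Ω → ℝ} {α v : ℝ}
    (hZ : ∀ n, Measurable[F n] fun ω => ∑ t ∈ Finset.range n, Z t ω)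
    (h : ∀ t, ∀ W : Ω → ℝ≥0∞, Measurable[F t] W →
      ∫⁻ ω, W ω * ENNReal.ofReal (Real.exp (α * Z t ω)) ∂P ≤
        ENNReal.ofReal (Real.exp (α ^ 2 * v / 2)) * ∫⁻ ω, W ω ∂P) (n : ℕ) :
    ∫⁻ ω, ENNReal.ofReal (Real.exp (α * ∑ t ∈ Finset.range n, Z t ω)) ∂P ≤
      ENNReal.ofReal (Real.exp (α ^ 2 * (n * v) / 2)) := by
  induction n with
  | zero => simp
  | succ n ih =>
    have hm : Measurable[F n] fun ω =>
        ENNReal.ofReal (Real.exp (α * ∑ t ∈ Finset.range n, Z t ω)) :=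
      (Real.measurable_exp.comp ((hZ n).const_mul α)).ennreal_ofReal
    calc ∫⁻ ω, ENNReal.ofReal (Real.exp (α * ∑ t ∈ Finset.range (n + 1), Z t ω)) ∂P
        = ∫⁻ ω, ENNReal.ofReal (Real.exp (α * ∑ t ∈ Finset.range n, Z t ω)) *
            ENNReal.ofReal (Real.exp (α * Z n ω)) ∂P := by
          refine lintegral_congr fun ω => ?_
          rw [← ENNReal.ofReal_mul (Real.exp_pos _).le, ← Real.exp_add, Finset.sum_range_succ,
            mul_add]
      _ ≤ _ := h n _ hm
      _ ≤ ENNReal.ofReal (Real.exp (α ^ 2 * v / 2)) *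
            ENNReal.ofReal (Real.exp (α ^ 2 * (n * v) / 2)) := mul_le_mul_right ih _
      _ = _ := by
          rw [← ENNReal.ofReal_mul (Real.exp_pos _).le, ← Real.exp_add]
          push_cast
          ring_nf

theorem measureReal_abs_ge_le {Ω : Type*} {mΩ : MeasurableSpace Ω} {P : Measure Ω}
    [IsProbabilityMeasure P] {X : Ω → ℝ} (hX : Measurable X) {v : ℝ≥0}
    (h : ∀ α : ℝ, ∫⁻ ω, ENNReal.ofReal (Real.exp (α * X ω)) ∂P ≤
      ENNReal.ofReal (Real.exp (α ^ 2 * v / 2))) {s : ℝ} (hs : 0 ≤ s) :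
    P.real {ω | s ≤ |X ω|} ≤ 2 * Real.exp (-s ^ 2 / (2 * v)) := by
  have hint : ∀ α : ℝ, Integrable (fun ω => Real.exp (α * X ω)) P := fun α =>
    ⟨(by fun_prop), by
      rw [hasFiniteIntegral_iff_ofReal (ae_of_all _ fun ω => (Real.exp_pos _).le)]
      exact (h α).trans_lt ENNReal.ofReal_lt_top⟩
  have hsg : HasSubgaussianMGF X v P := by
    refine ⟨hint, fun α => ?_⟩
    have := h α
    rw [← ofReal_integral_eq_lintegral_ofReal (hint α)
      (ae_of_all _ fun ω => (Real.exp_pos _).le),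
      ENNReal.ofReal_le_ofReal_iff (Real.exp_pos _).le] at this
    refine this.trans_eq ?_
    ring_nf
  have hcover : {ω | s ≤ |X ω|} ⊆ {ω | s ≤ X ω} ∪ {ω | s ≤ (-X) ω} := by
    intro ω hω
    rcases le_abs.1 (show s ≤ |X ω| from hω) with h | h
    · exact Or.inl h
    · exact Or.inr h
  calc P.real {ω | s ≤ |X ω|} ≤ P.real ({ω | s ≤ X ω} ∪ {ω | s ≤ (-X) ω}) :=
        measureReal_mono hcover
    _ ≤ P.real {ω | s ≤ X ω} + P.real {ω | s ≤ (-X) ω} := measureReal_union_le _ _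
    _ ≤ _ := by
      rw [two_mul]
      exact add_le_add (hsg.measure_ge_le hs) (hsg.neg.measure_ge_le hs)

/-! ### Deterministic analysis of the Lasso -/

theorem l1On_nonneg {d : ℕ} (S : Finset (Fin d)) (β : Vec d) : 0 ≤ l1On S β :=
  Finset.sum_nonneg fun _ _ => abs_nonneg _

theorem l1On_add_l1On_compl {d : ℕ} (S : Finset (Fin d)) (β : Vec d) :
    l1On S β + l1On Sᶜ β = l1Norm β := Finset.sum_add_sum_compl S _

theorem l1Norm_add_smul_sub_le {d : ℕ} (β γ : Vec d) {θ : ℝ} (h0 : 0 ≤ θ) (h1 : θ ≤ 1) :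
    l1Norm (β + θ • (γ - β)) ≤ l1Norm β + θ * (l1Norm γ - l1Norm β) := by
  have : ∀ j, |(β + θ • (γ - β)) j| ≤ (1 - θ) * |β j| + θ * |γ j| := fun j => by
    have e : (β + θ • (γ - β)) j = (1 - θ) * β j + θ * γ j := by
      simp only [PiLp.add_apply, PiLp.smul_apply, PiLp.sub_apply, smul_eq_mul]; ring
    rw [e]
    refine (abs_add_le _ _).trans_eq ?_
    rw [abs_mul, abs_mul, abs_of_nonneg h0, abs_of_nonneg (sub_nonneg.2 h1)]
  calc l1Norm (β + θ • (γ - β)) ≤ ∑ j, ((1 - θ) * |β j| + θ * |γ j|) :=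
        by rw [l1Norm, l1On]; exact Finset.sum_le_sum fun j _ => this j
    _ = _ := by
      simp only [l1Norm, l1On, Finset.sum_add_distrib, ← Finset.mul_sum]; ring

/-- First-order optimality of a Lasso estimate. -/
theorem lasso_first_order {d n : ℕ} {m μ : ℝ → ℝ} {lam : ℝ} (hlam : 0 ≤ lam)
    (hm : ∀ z, HasDerivAt m (μ z) z) {D : Fin n → Vec d × ℝ} {β : Vec d}
    (hmin : ∀ γ, lassoObjective m lam D β ≤ lassoObjective m lam D γ) (γ : Vec d) :
    lam * (l1Norm β - l1Norm γ) ≤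
      1 / (n : ℝ) * ∑ j, ((D j).2 - μ (inner ℝ (D j).1 β)) * inner ℝ (D j).1 (β - γ) := by
  let a : Fin n → ℝ := fun j => inner ℝ (D j).1 β
  let h : Fin n → ℝ := fun j => inner ℝ (D j).1 (γ - β)
  -- `f` is the objective along the segment from `β` to `γ` with the penalty replaced by its chord.
  -- By convexity it majorizes the objective and agrees with it at `θ = 0`; unlike the penalty, it
  -- is differentiable there.
  let f : ℝ → ℝ := fun θ => -(1 / (n : ℝ)) * ∑ j, ((D j).2 * (a j + θ * h j) - m (a j + θ * h j)) +
    lam * (l1Norm β + θ * (l1Norm γ - l1Norm β))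
  have hline : ∀ j, ∀ x : ℝ, HasDerivAt (fun θ : ℝ => a j + θ * h j) (h j) x := fun j x => by
    simpa using ((hasDerivAt_id x).mul_const (h j)).const_add (a j)
  have hf : HasDerivAt f (-(1 / (n : ℝ)) * ∑ j, ((D j).2 * h j - μ (a j) * h j) +
      lam * (l1Norm γ - l1Norm β)) 0 := by
    refine HasDerivAt.add (HasDerivAt.const_mul _ (HasDerivAt.fun_sum fun j _ => ?_)) ?_
    · refine ((hline j 0).const_mul _).sub ?_
      have := (hm (a j + 0 * h j)).comp (0 : ℝ) (hline j 0)
      simpa [Function.comp_def] using! this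
    · refine HasDerivAt.const_mul _ ?_
      simpa using ((hasDerivAt_id (0 : ℝ)).mul_const (l1Norm γ - l1Norm β)).const_add (l1Norm β)
  have hge : ∀ θ, 0 ≤ θ → θ ≤ 1 → f 0 ≤ f θ := by
    intro θ h0 h1
    have e := hmin (β + θ • (γ - β))
    have l := mul_le_mul_of_nonneg_left (l1Norm_add_smul_sub_le β γ h0 h1) hlam
    simp only [lassoObjective, inner_add_right, inner_smul_right] at e
    simp only [f, a, h, zero_mul, add_zero]
    linarith
  have hnn := ge_of_tendsto (b := (0 : ℝ)) hf.tendsto_slope_zero_right (by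
    filter_upwards [Ioo_mem_nhdsGT (zero_lt_one' ℝ)] with t ht
    rw [zero_add, smul_eq_mul]
    exact mul_nonneg (inv_nonneg.2 ht.1.le) (sub_nonneg.2 (hge t ht.1.le ht.2.le)))
  have e : ∑ j, ((D j).2 - μ (inner ℝ (D j).1 β)) * inner ℝ (D j).1 (β - γ) =
      -∑ j, ((D j).2 * h j - μ (a j) * h j) := by
    rw [← Finset.sum_neg_distrib]
    refine Finset.sum_congr rfl fun j _ => ?_
    rw [← neg_sub γ β, inner_neg_right]
    simp only [a, h]; ring
  rw [e]
  linarith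

/-- Strong monotonicity of the link: this is what turns a difference of residuals into a quadratic
prediction error. -/
theorem mul_sq_sub_le_of_le_deriv {μ : ℝ → ℝ} {κ : ℝ} (hd : Differentiable ℝ μ)
    (hκ : ∀ z, κ ≤ deriv μ z) (a b : ℝ) : κ * (a - b) ^ 2 ≤ (μ a - μ b) * (a - b) := by
  rcases le_total b a with h | h
  · have := mul_sub_le_image_sub_of_le_deriv hd hκ h
    nlinarith
  · have := mul_sub_le_image_sub_of_le_deriv hd hκ h
    nlinarith

/-- Off its active set `γ` vanishes, so there the error is `β` itself; on the active set the
triangle inequality applies. -/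
theorem l1On_compl_activeSet_sub_le {d : ℕ} (β γ : Vec d) :
    l1On (activeSet γ)ᶜ (β - γ) - l1On (activeSet γ) (β - γ) ≤ l1Norm β - l1Norm γ := by
  have h1 : l1On (activeSet γ)ᶜ (β - γ) = l1On (activeSet γ)ᶜ β := by
    refine Finset.sum_congr rfl fun j hj => ?_
    have : γ j = 0 := by simpa [activeSet] using hj
    simp [this]
  have h2 : l1On (activeSet γ)ᶜ γ = 0 := by
    refine Finset.sum_eq_zero fun j hj => ?_
    have : γ j = 0 := by simpa [activeSet] using hj
    simp [this]
  have h3 : l1On (activeSet γ) γ ≤ l1On (activeSet γ) β + l1On (activeSet γ) (β - γ) := by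
    rw [l1On, l1On, l1On, ← Finset.sum_add_distrib]
    refine Finset.sum_le_sum fun j _ => ?_
    have := abs_sub_abs_le_abs_sub (γ j) (β j)
    rw [abs_sub_comm] at this
    simp only [PiLp.sub_apply]
    linarith
  rw [← l1On_add_l1On_compl (activeSet γ) β, ← l1On_add_l1On_compl (activeSet γ) γ]
  linarith

/-- Basic inequality for a Lasso estimate whose noise is dominated by the penalty. -/
theorem lasso_basic_inequality {d n : ℕ} {m μ : ℝ → ℝ} {lam κ : ℝ} (hlam : 0 ≤ lam)
    (hm : ∀ z, HasDerivAt m (μ z) z) (hd : Differentiable ℝ μ) (hκ : ∀ z, κ ≤ deriv μ z)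
    {D : Fin n → Vec d × ℝ} {β γ : Vec d}
    (hmin : ∀ γ, lassoObjective m lam D β ≤ lassoObjective m lam D γ)
    (hnoise : ∀ k, |1 / (n : ℝ) * ∑ j, (D j).1 k * ((D j).2 - μ (inner ℝ (D j).1 γ))| ≤ lam / 2) :
    κ * (1 / (n : ℝ) * ∑ j, inner ℝ (D j).1 (β - γ) ^ 2) ≤
      3 / 2 * lam * l1On (activeSet γ) (β - γ) - 1 / 2 * lam * l1On (activeSet γ)ᶜ (β - γ) := by
  have h1 := lasso_first_order hlam hm hmin γ
  have h2 : 1 / (n : ℝ) * ∑ j, ((D j).2 - μ (inner ℝ (D j).1 γ)) * inner ℝ (D j).1 (β - γ) ≤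
      lam / 2 * l1Norm (β - γ) := by
    have e : 1 / (n : ℝ) * ∑ j, ((D j).2 - μ (inner ℝ (D j).1 γ)) * inner ℝ (D j).1 (β - γ) =
        ∑ k, (1 / (n : ℝ) * ∑ j, (D j).1 k * ((D j).2 - μ (inner ℝ (D j).1 γ))) * (β - γ) k := by
      simp only [PiLp.inner_apply, RCLike.inner_apply, conj_trivial, Finset.mul_sum,
        Finset.sum_mul]
      rw [Finset.sum_comm]
      refine Finset.sum_congr rfl fun _ _ => Finset.sum_congr rfl fun _ _ => ?_
      ring
    rw [e, l1Norm, l1On, Finset.mul_sum]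
    refine Finset.sum_le_sum fun k _ => (le_abs_self _).trans ?_
    rw [abs_mul]
    exact mul_le_mul_of_nonneg_right (hnoise k) (abs_nonneg _)
  have h3 : κ * (1 / (n : ℝ) * ∑ j, inner ℝ (D j).1 (β - γ) ^ 2) ≤
      1 / (n : ℝ) * ∑ j, ((D j).2 - μ (inner ℝ (D j).1 γ)) * inner ℝ (D j).1 (β - γ) -
      1 / (n : ℝ) * ∑ j, ((D j).2 - μ (inner ℝ (D j).1 β)) * inner ℝ (D j).1 (β - γ) := by
    rw [mul_left_comm, ← mul_sub, ← Finset.sum_sub_distrib, Finset.mul_sum]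
    refine mul_le_mul_of_nonneg_left (Finset.sum_le_sum fun j _ => ?_) (by positivity)
    have := mul_sq_sub_le_of_le_deriv hd hκ (inner ℝ (D j).1 β) (inner ℝ (D j).1 γ)
    rw [← inner_sub_right] at this
    linarith
  have h4 := mul_le_mul_of_nonneg_left (l1On_compl_activeSet_sub_le β γ) hlam
  have h5 := l1On_add_l1On_compl (activeSet γ) (β - γ)
  rw [← h5] at h2
  linarith

theorem dotProduct_mulVec_eq_sum {d : ℕ} (M : Matrix (Fin d) (Fin d) ℝ) (v : Vec d) :
    v.ofLp ⬝ᵥ M.mulVec v.ofLp = ∑ j, ∑ k, M j k * (v j * v k) := by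
  simp only [dotProduct, Matrix.mulVec, Finset.mul_sum]
  exact Finset.sum_congr rfl fun _ _ => Finset.sum_congr rfl fun _ _ => by ring

theorem dotProduct_mulVec_le_add {d : ℕ} {G M : Matrix (Fin d) (Fin d) ℝ} {η : ℝ}
    (h : ∀ j k, |G j k - M j k| ≤ η) (v : Vec d) :
    v.ofLp ⬝ᵥ M.mulVec v.ofLp ≤ v.ofLp ⬝ᵥ G.mulVec v.ofLp + η * l1Norm v ^ 2 := by
  rw [dotProduct_mulVec_eq_sum, dotProduct_mulVec_eq_sum, sq, l1Norm, l1On, Finset.sum_mul_sum,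
    Finset.mul_sum, ← Finset.sum_add_distrib]
  refine Finset.sum_le_sum fun j _ => ?_
  rw [Finset.mul_sum, ← Finset.sum_add_distrib]
  refine Finset.sum_le_sum fun k _ => ?_
  have h1 : (M j k - G j k) * (v j * v k) ≤ η * (|v j| * |v k|) := by
    refine (le_abs_self _).trans ?_
    rw [abs_mul, abs_sub_comm, abs_mul]
    exact mul_le_mul_of_nonneg_right (h j k) (by positivity)
  linarith

/-- Prediction error bound under the compatibility condition. -/
theorem quadratic_le_of_compatibility {d : ℕ} {A M G : Matrix (Fin d) (Fin d) ℝ}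
    {S : Finset (Fin d)} {φ ν κ lam : ℝ} (hS : 1 ≤ S.card) (hφ : 0 < φ) (hν : 0 < ν) (hκ : 0 < κ)
    (hlam : 0 < lam) (hA : CompatibilityCondition A S φ) {v : Vec d}
    (hG0 : 0 ≤ v.ofLp ⬝ᵥ G.mulVec v.ofLp)
    (hAM : v.ofLp ⬝ᵥ A.mulVec v.ofLp ≤ ν * (v.ofLp ⬝ᵥ M.mulVec v.ofLp))
    (hGM : ∀ j k, |G j k - M j k| ≤ φ ^ 2 / (64 * S.card * ν))
    (hG : κ * (v.ofLp ⬝ᵥ G.mulVec v.ofLp) ≤ 3 / 2 * lam * l1On S v - 1 / 2 * lam * l1On Sᶜ v) :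
    v.ofLp ⬝ᵥ A.mulVec v.ofLp ≤ 4 * ν ^ 2 * lam ^ 2 * S.card / (κ ^ 2 * φ ^ 2) := by
  have hs : (1 : ℝ) ≤ S.card := by exact_mod_cast hS
  -- The left side of `hG` is nonnegative, which forces the cone condition with the constant `3 =
  -- (3/2) / (1/2)`.
  have hcone : l1On Sᶜ v ≤ 3 * l1On S v := by
    have : 0 ≤ 3 / 2 * lam * l1On S v - 1 / 2 * lam * l1On Sᶜ v :=
      (mul_nonneg hκ.le hG0).trans hG
    by_contra! hc
    nlinarith
  have hcomp := hA v hcone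
  have hpert := dotProduct_mulVec_le_add hGM v
  rw [← l1On_add_l1On_compl S v] at hpert
  set q := v.ofLp ⬝ᵥ A.mulVec v.ofLp
  set g := v.ofLp ⬝ᵥ G.mulVec v.ofLp
  set r := v.ofLp ⬝ᵥ M.mulVec v.ofLp
  set a := l1On S v
  set b := l1On Sᶜ v
  set s : ℝ := (S.card : ℝ)
  have ha : 0 ≤ a := l1On_nonneg _ _
  have hb : 0 ≤ b := l1On_nonneg _ _
  -- On the cone `‖v‖₁ ≤ 4 ‖v_S‖₁`, so the perturbation carries a factor `16`. The constant `64 = 16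
  -- · 4` is chosen so that only `q / (4 ν)` is lost.
  have h1 : φ ^ 2 / (64 * s * ν) * (a + b) ^ 2 ≤ q / (4 * ν) := by
    have : (a + b) ^ 2 ≤ 16 * a ^ 2 := by nlinarith
    calc φ ^ 2 / (64 * s * ν) * (a + b) ^ 2 ≤ φ ^ 2 / (64 * s * ν) * (16 * a ^ 2) := by gcongr
      _ = (φ ^ 2 * a ^ 2) / (4 * s * ν) := by field_simp; ring
      _ ≤ (s * q) / (4 * s * ν) := by gcongr
      _ = q / (4 * ν) := by field_simp
  have h2 : q ≤ ν * g + q / 4 := by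
    have := mul_le_mul_of_nonneg_left (hpert.trans (add_le_add_right h1 g)) hν.le
    have e : ν * (g + q / (4 * ν)) = ν * g + q / 4 := by field_simp
    rw [e] at this
    exact hAM.trans this
  have h3 : κ * q ≤ 2 * ν * lam * a := by
    have : κ * g ≤ 3 / 2 * lam * a := by nlinarith
    nlinarith
  have hq : 0 ≤ q := by
    have : 0 ≤ s * q := le_trans (by positivity) hcomp
    exact nonneg_of_mul_nonneg_right this (by linarith)
  rw [le_div_iff₀ (by positivity)]
  -- Squaring `h3` and applying compatibility once more bounds `q²` by a multiple of `q`, so a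
  -- factor `q > 0` is cancelled.
  rcases hq.eq_or_lt with h0 | hq
  · rw [← h0]; simp only [zero_mul]; positivity
  refine le_of_mul_le_mul_left ?_ hq
  calc q * (q * (κ ^ 2 * φ ^ 2)) = (κ * q) ^ 2 * φ ^ 2 := by ring
    _ ≤ (2 * ν * lam * a) ^ 2 * φ ^ 2 := by gcongr
    _ = 4 * ν ^ 2 * lam ^ 2 * (φ ^ 2 * a ^ 2) := by ring
    _ ≤ 4 * ν ^ 2 * lam ^ 2 * (s * q) := by gcongr
    _ = _ := by ring

/-! ### The Gram matrix of the greedily chosen features -/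

/-- The law of a fair coin. -/
noncomputable def fairCoin : Measure (Fin 2) := (2 : ℝ≥0∞)⁻¹ • Measure.count

theorem lintegral_fairCoin (f : Fin 2 → ℝ≥0∞) : ∫⁻ u, f u ∂fairCoin = 2⁻¹ * (f 0 + f 1) := by
  rw [fairCoin, lintegral_smul_measure, lintegral_count, tsum_fintype, Fin.sum_univ_two,
    smul_eq_mul]

instance : IsProbabilityMeasure fairCoin := ⟨by
  have := lintegral_fairCoin fun _ => 1
  rw [lintegral_one] at this
  rw [this, one_add_one_eq_two, ENNReal.inv_mul_cancel two_ne_zero ENNReal.ofNat_ne_top]⟩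

/-- The feature vector of the greedy arm. -/
noncomputable def greedyFeature {d : ℕ} (β : Vec d) (x : Contexts d) (u : Fin 2) : Vec d := x (greedyArm β x u)

theorem measurable_greedyArm {d : ℕ} :
    Measurable fun p : Vec d × Contexts d × Fin 2 => greedyArm p.1 p.2.1 p.2.2 := by
  have h : ∀ i : Fin 2, Measurable fun p : Vec d × Contexts d × Fin 2 => inner ℝ (p.2.1 i) p.1 :=
    fun i => by fun_prop
  exact Measurable.ite (measurableSet_lt (h 0) (h 1)) measurable_const
    (Measurable.ite (measurableSet_lt (h 1) (h 0)) measurable_const (by fun_prop))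

theorem measurable_apply_fin_two {Ω E : Type*} {mΩ : MeasurableSpace Ω} [MeasurableSpace E]
    {f : Ω → Fin 2 → E} {i : Ω → Fin 2} (hf : ∀ j, Measurable fun ω => f ω j)
    (hi : Measurable i) : Measurable fun ω => f ω (i ω) := by
  have : (fun ω => f ω (i ω)) = fun ω => if i ω = 0 then f ω 0 else f ω 1 := by
    funext ω
    split_ifs with h
    · rw [h]
    · rw [show i ω = 1 by omega]
  rw [this]
  exact Measurable.ite (hi (measurableSet_singleton 0)) (hf 0) (hf 1)

theorem measurable_greedyFeature {d : ℕ} :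
    Measurable fun p : Vec d × Contexts d × Fin 2 => greedyFeature p.1 p.2.1 p.2.2 :=
  measurable_apply_fin_two (f := fun p : Vec d × Contexts d × Fin 2 => p.2.1)
    (fun j => by fun_prop) measurable_greedyArm

/-- The Gram matrix of the feature vector of the greedy arm. -/
noncomputable def greedyGram {d : ℕ} (law : Measure (Contexts d)) (β : Vec d) :
    Matrix (Fin d) (Fin d) ℝ :=
  Matrix.of fun j k =>
    ∫ z, greedyFeature β z.1 z.2 j * greedyFeature β z.1 z.2 k ∂(law.prod fairCoin)

theorem abs_mul_apply_le_sq {d : ℕ} {x : Vec d} {K : ℝ} (hx : ‖x‖ ≤ K) (j k : Fin d) :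
    |x j * x k| ≤ K ^ 2 := by
  have h1 := (PiLp.norm_apply_le x j).trans hx
  have h2 := (PiLp.norm_apply_le x k).trans hx
  rw [Real.norm_eq_abs] at h1 h2
  rw [abs_mul, sq]
  exact mul_le_mul h1 h2 (abs_nonneg _) ((abs_nonneg _).trans h1)

theorem integrable_mul_apply {E : Type*} [MeasurableSpace E] {μ : Measure E} [IsFiniteMeasure μ]
    {d : ℕ} {Y : E → Vec d} (hY : Measurable Y) {K : ℝ} (hK : ∀ᵐ x ∂μ, ‖Y x‖ ≤ K) (j k : Fin d) :
    Integrable (fun x => Y x j * Y x k) μ :=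
  Integrable.of_bound (by fun_prop) (K ^ 2) (hK.mono fun x hx => abs_mul_apply_le_sq hx j k)

theorem inner_sq_eq_sum {d : ℕ} (x v : Vec d) :
    inner ℝ x v ^ 2 = ∑ j, ∑ k, x j * x k * (v j * v k) := by
  simp only [PiLp.inner_apply, RCLike.inner_apply, conj_trivial, sq, Finset.sum_mul_sum]
  exact Finset.sum_congr rfl fun _ _ => Finset.sum_congr rfl fun _ _ => by ring

/-- The quadratic form of a matrix of second moments. -/
theorem dotProduct_secondMoment_mulVec {E : Type*} [MeasurableSpace E] {μ : Measure E}
    [IsFiniteMeasure μ] {d : ℕ} {Y : E → Vec d} (hY : Measurable Y) {K : ℝ}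
    (hK : ∀ᵐ x ∂μ, ‖Y x‖ ≤ K) (v : Vec d) :
    v.ofLp ⬝ᵥ (Matrix.of fun j k => ∫ x, Y x j * Y x k ∂μ).mulVec v.ofLp =
      ∫ x, inner ℝ (Y x) v ^ 2 ∂μ := by
  rw [dotProduct_mulVec_eq_sum]
  simp only [inner_sq_eq_sum, Matrix.of_apply]
  have hi : ∀ j k, Integrable (fun x => Y x j * Y x k * (v j * v k)) μ := fun j k =>
    (integrable_mul_apply hY hK j k).mul_const _
  rw [integral_finsetSum _ fun j _ => integrable_finsetSum _ fun k _ => hi j k]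
  refine Finset.sum_congr rfl fun j _ => ?_
  rw [integral_finsetSum _ fun k _ => hi j k]
  exact Finset.sum_congr rfl fun k _ => (integral_mul_const _ _).symm

section Law

variable {d : ℕ} {law : Measure (Contexts d)} {K : ℝ}

theorem dotProduct_gramMatrix_mulVec [IsProbabilityMeasure law]
    (hK : ∀ᵐ x ∂law, ∀ i, ‖x i‖ ≤ K) (v : Vec d) :
    v.ofLp ⬝ᵥ (gramMatrix law).mulVec v.ofLp =
      1 / 2 * ∑ i : Fin 2, ∫ x, inner ℝ (x i) v ^ 2 ∂law := by
  have h : ∀ i : Fin 2, _ := fun i => dotProduct_secondMoment_mulVec (μ := law)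
    (Y := fun x : Contexts d => x i) (measurable_pi_apply i) (hK.mono fun x hx => hx i) v
  simp only [← h, dotProduct_mulVec_eq_sum, gramMatrix, Matrix.of_apply, Fin.sum_univ_two, mul_add,
    add_mul, Finset.sum_add_distrib, Finset.mul_sum, mul_assoc]

theorem ae_norm_greedyFeature_le (hK : ∀ᵐ x ∂law, ∀ i, ‖x i‖ ≤ K) (β : Vec d) :
    ∀ᵐ z ∂(law.prod fairCoin), ‖greedyFeature β z.1 z.2‖ ≤ K := by
  have := (Measure.quasiMeasurePreserving_fst (μ := law) (ν := fairCoin)).ae hK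
  exact this.mono fun z hz => hz _

theorem measurable_greedyFeature_left (β : Vec d) :
    Measurable fun z : Contexts d × Fin 2 => greedyFeature β z.1 z.2 :=
  measurable_greedyFeature.comp (measurable_const.prodMk measurable_id)

theorem dotProduct_greedyGram_mulVec [IsProbabilityMeasure law]
    (hK : ∀ᵐ x ∂law, ∀ i, ‖x i‖ ≤ K) (β v : Vec d) :
    v.ofLp ⬝ᵥ (greedyGram law β).mulVec v.ofLp =
      ∫ z, inner ℝ (greedyFeature β z.1 z.2) v ^ 2 ∂(law.prod fairCoin) :=
  dotProduct_secondMoment_mulVec (measurable_greedyFeature_left β)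
    (ae_norm_greedyFeature_le hK β) v

/-- Hoeffding's lemma for the entries of the Gram matrix of the greedy feature. -/
theorem lintegral_exp_greedyFeature_le [IsProbabilityMeasure law]
    (hK : ∀ᵐ x ∂law, ∀ i, ‖x i‖ ≤ K) (β : Vec d)
    (j k : Fin d) (α : ℝ) :
    ∫⁻ z, ENNReal.ofReal (Real.exp (α * (greedyFeature β z.1 z.2 j * greedyFeature β z.1 z.2 k -
      greedyGram law β j k))) ∂(law.prod fairCoin) ≤
      ENNReal.ofReal (Real.exp (α ^ 2 * (K ^ 2) ^ 2 / 2)) := by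
  have hm := measurable_greedyFeature_left β
  rw [show greedyGram law β j k = ∫ z, greedyFeature β z.1 z.2 j * greedyFeature β z.1 z.2 k
    ∂(law.prod fairCoin) from rfl]
  -- Half the length of `[-K², K²]` is `K²`, hence the variance proxy `(K²)²`.
  have h := hasSubgaussianMGF_of_mem_Icc (μ := law.prod fairCoin) (a := -K ^ 2) (b := K ^ 2)
    (X := fun z => greedyFeature β z.1 z.2 j * greedyFeature β z.1 z.2 k) (by fun_prop)
    ((ae_norm_greedyFeature_le hK β).mono fun z hz =>
      Set.mem_Icc.2 (abs_le.1 (abs_mul_apply_le_sq hz j k)))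
  rw [← ofReal_integral_eq_lintegral_ofReal (h.integrable_exp_mul α)
    (ae_of_all _ fun _ => (Real.exp_pos _).le)]
  refine ENNReal.ofReal_le_ofReal ((h.mgf_le α).trans_eq ?_)
  have e : K ^ 2 - -K ^ 2 = 2 * K ^ 2 := by ring
  have e2 : (((‖K ^ 2 - -K ^ 2‖₊ / 2) ^ 2 : ℝ≥0) : ℝ) = (K ^ 2) ^ 2 := by
    rw [e]
    push_cast
    rw [Real.norm_of_nonneg (by positivity)]
    ring
  rw [e2]
  ring_nf

end Law

/-! ### Reflection and relaxed symmetry -/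

/-- The arm played for reflected features, averaged over the coin. -/
theorem lintegral_greedyArm_add_neg {d : ℕ} (β : Vec d) (x : Contexts d) (F : Fin 2 → ℝ≥0∞) :
    ∫⁻ u, F (greedyArm β x u) ∂fairCoin + ∫⁻ u, F (greedyArm β (-x) u) ∂fairCoin = F 0 + F 1 := by
  have h2 : (2 : ℝ≥0∞)⁻¹ * 2 = 1 := ENNReal.inv_mul_cancel two_ne_zero ENNReal.ofNat_ne_top
  rw [lintegral_fairCoin, lintegral_fairCoin]
  simp only [greedyArm, Pi.neg_apply, inner_neg_left, neg_lt_neg_iff]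
  rcases lt_trichotomy (inner ℝ (x 0) β) (inner ℝ (x 1) β) with h | h | h
  · simp only [h, h.not_gt, if_true, if_false]
    calc _ = 2⁻¹ * 2 * (F 0 + F 1) := by ring
      _ = _ := by rw [h2, one_mul]
  · simp only [h, lt_irrefl, if_false]
    calc _ = 2⁻¹ * 2 * (F 0 + F 1) := by ring
      _ = _ := by rw [h2, one_mul]
  · simp only [h, h.not_gt, if_true, if_false]
    calc _ = 2⁻¹ * 2 * (F 0 + F 1) := by ring
      _ = _ := by rw [h2, one_mul]

namespace GLMBandit

variable {d : ℕ} {Ω : Type*} (B : GLMBandit d Ω)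

/-- Applying the inequality twice gives `p(x) ≤ ν² p(x)`, and `p` is positive somewhere. This also
supplies the positivity of `ν` needed later. -/
theorem one_le_of_relaxed_symmetry [IsProbabilityMeasure B.law] {ν : ℝ}
    (hν : ∀ x, (B.density (-x) : ℝ) ≤ ν * B.density x) : 1 ≤ ν := by
  obtain ⟨x, hx⟩ : ∃ x, B.density x ≠ 0 := by
    by_contra! h
    have : B.law = 0 := by simp [GLMBandit.law, h]
    exact IsProbabilityMeasure.ne_zero B.law this
  have hx : (0 : ℝ) < B.density x := by
    exact_mod_cast pos_iff_ne_zero.2 hx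
  have h1 := hν x
  have h2 := hν (-x)
  rw [neg_neg] at h2
  have h3 : (0 : ℝ) ≤ B.density (-x) := NNReal.coe_nonneg _
  have hν0 : 0 < ν := by
    by_contra! h
    nlinarith
  by_contra! h
  nlinarith [mul_le_mul_of_nonneg_left h1 hν0.le]

/-- Lebesgue measure is invariant under reflection, so the reflection can be moved onto the density.
-/
theorem lintegral_neg_law_le (hd : Measurable B.density) {ν : ℝ} (hν0 : 0 ≤ ν)
    (hν : ∀ x, (B.density (-x) : ℝ) ≤ ν * B.density x) {H : Contexts d → ℝ≥0∞}
    (hH : Measurable H) :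
    ∫⁻ x, H (-x) ∂B.law ≤ ENNReal.ofReal ν * ∫⁻ x, H x ∂B.law := by
  have hH' : Measurable fun x : Contexts d => H (-x) := hH.comp measurable_neg
  have hd' : Measurable fun x => (B.density x : ℝ≥0∞) := hd.coe_nnreal_ennreal
  rw [GLMBandit.law, lintegral_withDensity_eq_lintegral_mul _ hd' hH,
    lintegral_withDensity_eq_lintegral_mul _ hd' hH',
    ← lintegral_const_mul _ (hd'.mul hH)]
  simp only [Pi.mul_apply]
  have : (volume : Measure (Contexts d)).IsNegInvariant := Measure.pi.isNegInvariant _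
  rw [← lintegral_neg_eq_self]
  refine lintegral_mono fun x => ?_
  simp only [neg_neg]
  rw [← mul_assoc]
  refine mul_le_mul_left ?_ _
  rw [← ENNReal.ofReal_coe_nnreal, ← ENNReal.ofReal_coe_nnreal, ← ENNReal.ofReal_mul hν0]
  exact ENNReal.ofReal_le_ofReal (hν x)

/-- Under relaxed symmetry the greedy choice loses at most a factor `ν` of the Gram matrix. -/
theorem gramMatrix_le_greedyGram [IsProbabilityMeasure B.law] (hd : Measurable B.density) {ν : ℝ}
    (hν : ∀ x, (B.density (-x) : ℝ) ≤ ν * B.density x) {K : ℝ}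
    (hK : ∀ᵐ x ∂B.law, ∀ i, ‖x i‖ ≤ K) (β v : Vec d) :
    v.ofLp ⬝ᵥ (gramMatrix B.law).mulVec v.ofLp ≤
      ν * (v.ofLp ⬝ᵥ (greedyGram B.law β).mulVec v.ofLp) := by
  have hν1 : 1 ≤ ν := B.one_le_of_relaxed_symmetry hν
  have hgm := measurable_greedyFeature_left β
  let F : Contexts d → Fin 2 → ℝ≥0∞ := fun x i => ENNReal.ofReal (inner ℝ (x i) v ^ 2)
  let H : Contexts d → ℝ≥0∞ := fun x => ∫⁻ u, F x (greedyArm β x u) ∂fairCoin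
  have hFm : Measurable fun z : Contexts d × Fin 2 => F z.1 (greedyArm β z.1 z.2) :=
    ((hgm.inner measurable_const).pow_const 2).ennreal_ofReal
  have hHm : Measurable H := hFm.lintegral_prod_right'
  have hint : ∀ i : Fin 2, Integrable (fun x : Contexts d => inner ℝ (x i) v ^ 2) B.law :=
    fun i => Integrable.of_bound
      (Measurable.aestronglyMeasurable (by fun_prop)) ((K * ‖v‖) ^ 2) (hK.mono fun x hx => by
      rw [norm_pow]
      have := (norm_inner_le_norm (𝕜 := ℝ) (x i) v).trans
        (mul_le_mul_of_nonneg_right (hx i) (norm_nonneg v))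
      gcongr)
  have hintg : Integrable (fun z => inner ℝ (greedyFeature β z.1 z.2) v ^ 2)
      (B.law.prod fairCoin) :=
    Integrable.of_bound (by fun_prop) ((K * ‖v‖) ^ 2)
      ((ae_norm_greedyFeature_le hK β).mono fun z hz => by
        rw [norm_pow]
        have := (norm_inner_le_norm (𝕜 := ℝ) (greedyFeature β z.1 z.2) v).trans
          (mul_le_mul_of_nonneg_right hz (norm_nonneg v))
        gcongr)
  -- `H x` averages the played arm over the coin; `H x + H (-x)` recovers both arms, and the
  -- reflected integral costs a factor `ν`.
  have hsum : ∫⁻ x, (F x 0 + F x 1) ∂B.law ≤ ENNReal.ofReal (1 + ν) * ∫⁻ x, H x ∂B.law := by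
    calc ∫⁻ x, (F x 0 + F x 1) ∂B.law = ∫⁻ x, (H x + H (-x)) ∂B.law := by
          refine lintegral_congr fun x => ?_
          rw [← lintegral_greedyArm_add_neg β x]
          simp [H, F]
      _ = ∫⁻ x, H x ∂B.law + ∫⁻ x, H (-x) ∂B.law := lintegral_add_left hHm _
      _ ≤ ∫⁻ x, H x ∂B.law + ENNReal.ofReal ν * ∫⁻ x, H x ∂B.law :=
          add_le_add_right (B.lintegral_neg_law_le hd (by linarith) hν hHm) _
      _ = _ := by
          rw [ENNReal.ofReal_add zero_le_one (by linarith), add_mul, ENNReal.ofReal_one, one_mul]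
  have hL : ∫⁻ x, (F x 0 + F x 1) ∂B.law =
      ENNReal.ofReal (∑ i : Fin 2, ∫ x, inner ℝ (x i) v ^ 2 ∂B.law) := by
    rw [lintegral_add_left (by fun_prop), Fin.sum_univ_two,
      ENNReal.ofReal_add (integral_nonneg fun _ => sq_nonneg _)
        (integral_nonneg fun _ => sq_nonneg _),
      ofReal_integral_eq_lintegral_ofReal (hint 0) (ae_of_all _ fun _ => sq_nonneg _),
      ofReal_integral_eq_lintegral_ofReal (hint 1) (ae_of_all _ fun _ => sq_nonneg _)]
  have hR : ∫⁻ x, H x ∂B.law = ENNReal.ofReal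
      (∫ z, inner ℝ (greedyFeature β z.1 z.2) v ^ 2 ∂(B.law.prod fairCoin)) := by
    rw [ofReal_integral_eq_lintegral_ofReal hintg (ae_of_all _ fun _ => sq_nonneg _)]
    exact (lintegral_prod _ hFm.aemeasurable).symm
  have hg0 : 0 ≤ ∫ z, inner ℝ (greedyFeature β z.1 z.2) v ^ 2 ∂(B.law.prod fairCoin) :=
    integral_nonneg fun _ => sq_nonneg _
  rw [hL, hR, ← ENNReal.ofReal_mul (by linarith),
    ENNReal.ofReal_le_ofReal_iff (mul_nonneg (by linarith) hg0)] at hsum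
  rw [dotProduct_gramMatrix_mulVec hK, dotProduct_greedyGram_mulVec hK]
  -- The factor obtained is `(1 + ν) / 2`, which is at most `ν` because `ν ≥ 1`.
  nlinarith

end GLMBandit

/-! ### Measurability of the algorithm -/

namespace GLMBandit

variable {d : ℕ} {Ω : Type*} (B : GLMBandit d Ω) (est : (n : ℕ) → (Fin n → Vec d × ℝ) → Vec d)

/-- The estimate used in round `t`. -/
noncomputable def estimate (t : ℕ) (ω : Ω) : Vec d := est t (B.history est ω t)

/-- The feature vector of the arm played in round `t`. -/
noncomputable def feature (t : ℕ) (ω : Ω) : Vec d := B.ctx t ω (B.arm est t ω)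

theorem history_apply (ω : Ω) (n : ℕ) (j : Fin n) :
    B.history est ω n j = (B.feature est j ω, B.reward j (B.arm est j ω) ω) := by
  induction n with
  | zero => exact j.elim0
  | succ n ih =>
    induction j using Fin.lastCases with
    | last => rw [history, Fin.snoc_last]; rfl
    | cast j => rw [history, Fin.snoc_castSucc]; exact ih j

theorem measurable_ctx_past {s t : ℕ} (h : s < t) : Measurable[B.past t] (B.ctx s) := by
  refine measurable_iff_comap_le.2 (le_trans ?_ (le_iSup _ (⟨s, h⟩ : Fin t)))
  exact le_sup_left.trans le_sup_left

theorem measurable_coin_past {s t : ℕ} (h : s < t) : Measurable[B.past t] (B.coin s) := by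
  refine measurable_iff_comap_le.2 (le_trans ?_ (le_iSup _ (⟨s, h⟩ : Fin t)))
  exact le_sup_right.trans le_sup_left

theorem measurable_noise_past {s t : ℕ} (h : s < t) (i : Fin 2) :
    Measurable[B.past t] (B.noise s i) := by
  refine measurable_iff_comap_le.2 (le_trans ?_ (le_iSup _ (⟨s, h⟩ : Fin t)))
  exact (le_iSup (fun i => MeasurableSpace.comap (B.noise s i) inferInstance) i).trans le_sup_right

theorem past_mono {s t : ℕ} (h : s ≤ t) : B.past s ≤ B.past t :=
  iSup_le fun r => le_iSup_of_le (Fin.castLE h r) le_rfl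

theorem past_le_pastCtx (t : ℕ) : B.past t ≤ B.pastCtx t := le_sup_left

theorem past_le_preReward (t : ℕ) : B.past t ≤ B.preReward t :=
  (B.past_le_pastCtx t).trans le_sup_left

theorem measurable_ctx_pastCtx (t : ℕ) : Measurable[B.pastCtx t] (B.ctx t) :=
  measurable_iff_comap_le.2 le_sup_right

theorem measurable_ctx_preReward (t : ℕ) : Measurable[B.preReward t] (B.ctx t) :=
  (B.measurable_ctx_pastCtx t).mono le_sup_left le_rfl

theorem measurable_coin_preReward (t : ℕ) : Measurable[B.preReward t] (B.coin t) :=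
  measurable_iff_comap_le.2 le_sup_right

variable {est} (hest : ∀ n, Measurable (est n))

/-- A σ-algebra that knows the current estimate, features and coin knows the current arm. -/
theorem measurable_arm_of {m : MeasurableSpace Ω} {t : ℕ}
    (he : Measurable[m] (B.estimate est t)) (hx : Measurable[m] (B.ctx t))
    (hu : Measurable[m] (B.coin t)) : Measurable[m] (B.arm est t) :=
  measurable_greedyArm.comp (he.prodMk (hx.prodMk hu))

theorem measurable_feature_of {m : MeasurableSpace Ω} {t : ℕ}
    (he : Measurable[m] (B.estimate est t)) (hx : Measurable[m] (B.ctx t))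
    (hu : Measurable[m] (B.coin t)) : Measurable[m] (B.feature est t) :=
  measurable_greedyFeature.comp (he.prodMk (hx.prodMk hu))

include hest in
theorem measurable_history (hl : Measurable B.link) (n : ℕ) :
    Measurable[B.past n] fun ω => B.history est ω n := by
  induction n with
  | zero => exact @measurable_pi_lambda _ _ _ (B.past 0) _ _ fun j => j.elim0
  | succ n ih =>
    have he : Measurable[B.past (n + 1)] (B.estimate est n) :=
      (hest n).comp (ih.mono (B.past_mono n.le_succ) le_rfl)
    have hx := B.measurable_ctx_past n.lt_succ_self
    have hu := B.measurable_coin_past n.lt_succ_self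
    have ha := B.measurable_arm_of he hx hu
    refine @measurable_pi_lambda _ _ _ (B.past (n + 1)) _ _ fun j => ?_
    induction j using Fin.lastCases with
    | last =>
      have : (fun ω => B.history est ω (n + 1) (Fin.last n)) =
          fun ω => (B.feature est n ω, B.reward n (B.arm est n ω) ω) :=
        funext fun ω => B.history_apply est ω (n + 1) (Fin.last n)
      rw [this]
      refine (B.measurable_feature_of he hx hu).prodMk ?_
      refine measurable_apply_fin_two (f := fun ω i => B.reward n i ω) (fun i => ?_) ha
      have hxi : Measurable[B.past (n + 1)] fun ω => B.ctx n ω i := (measurable_pi_apply i).comp hx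
      exact (hl.comp (hxi.inner measurable_const)).add
        (B.measurable_noise_past n.lt_succ_self i)
    | cast j =>
      have : (fun ω => B.history est ω (n + 1) j.castSucc) = fun ω => B.history est ω n j := by
        funext ω
        rw [history, Fin.snoc_castSucc]
      rw [this]
      exact (measurable_pi_apply j).comp (ih.mono (B.past_mono n.le_succ) le_rfl)

include hest in
theorem measurable_estimate (hl : Measurable B.link) (t : ℕ) :
    Measurable[B.past t] (B.estimate est t) :=
  (hest t).comp (B.measurable_history hest hl t)

include hest in
theorem measurable_arm_preReward (hl : Measurable B.link) (t : ℕ) :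
    Measurable[B.preReward t] (B.arm est t) :=
  B.measurable_arm_of ((B.measurable_estimate hest hl t).mono (B.past_le_preReward t) le_rfl)
    (B.measurable_ctx_preReward t) (B.measurable_coin_preReward t)

include hest in
theorem measurable_arm_past (hl : Measurable B.link) {s t : ℕ} (h : s < t) :
    Measurable[B.past t] (B.arm est s) :=
  B.measurable_arm_of ((B.measurable_estimate hest hl s).mono (B.past_mono h.le) le_rfl)
    (B.measurable_ctx_past h) (B.measurable_coin_past h)

include hest in
theorem measurable_feature_past (hl : Measurable B.link) {s t : ℕ} (h : s < t) :
    Measurable[B.past t] (B.feature est s) :=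
  B.measurable_feature_of ((B.measurable_estimate hest hl s).mono (B.past_mono h.le) le_rfl)
    (B.measurable_ctx_past h) (B.measurable_coin_past h)

end GLMBandit

theorem measurable_greedyGram {d : ℕ} (law : Measure (Contexts d)) [IsProbabilityMeasure law]
    (j k : Fin d) : Measurable fun β => greedyGram law β j k := by
  have hm := measurable_greedyFeature (d := d)
  have : StronglyMeasurable (fun p : Vec d × Contexts d × Fin 2 =>
      greedyFeature p.1 p.2.1 p.2.2 j * greedyFeature p.1 p.2.1 p.2.2 k) :=
    Measurable.stronglyMeasurable (by fun_prop)
  exact (this.integral_prod_right' (ν := law.prod fairCoin)).measurable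

/-! ### Integrating out the randomness of one round -/

namespace GLMBandit.IsModel

variable {d : ℕ} {Ω : Type*} [mΩ : MeasurableSpace Ω] {P : Measure Ω}
  {B : GLMBandit d Ω} {σ : ℝ} (hB : B.IsModel P σ)

include hB

theorem past_le (t : ℕ) : B.past t ≤ mΩ :=
  iSup_le fun s => sup_le (sup_le (hB.measurable_ctx s).comap_le (hB.measurable_coin s).comap_le)
    (iSup_le fun i => (hB.measurable_noise s i).comap_le)

theorem pastCtx_le (t : ℕ) : B.pastCtx t ≤ mΩ :=
  sup_le (hB.past_le t) (hB.measurable_ctx t).comap_le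

theorem preReward_le (t : ℕ) : B.preReward t ≤ mΩ :=
  sup_le (hB.pastCtx_le t) (hB.measurable_coin t).comap_le

theorem isProbabilityMeasure_law [IsProbabilityMeasure P] : IsProbabilityMeasure B.law := by
  rw [← hB.ctx_law 0]
  exact Measure.isProbabilityMeasure_map (hB.measurable_ctx 0).aemeasurable

theorem map_coin (t : ℕ) : P.map (B.coin t) = fairCoin := by
  refine Measure.ext_of_singleton fun i => ?_
  rw [Measure.map_apply (hB.measurable_coin t) (measurableSet_singleton i), hB.coin_fair t i,
    fairCoin, Measure.smul_apply, Measure.count_singleton]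
  simp

theorem ae_law {xmax : ℝ} (h : ∀ᵐ ω ∂P, ∀ i, ‖B.ctx 0 ω i‖ ≤ xmax) :
    ∀ᵐ x ∂B.law, ∀ i, ‖x i‖ ≤ xmax := by
  rw [← hB.ctx_law 0]
  refine (ae_map_iff (hB.measurable_ctx 0).aemeasurable ?_).2 h
  have : {x : Contexts d | ∀ i, ‖x i‖ ≤ xmax} = ⋂ i, {x | ‖x i‖ ≤ xmax} := by ext; simp
  rw [this]
  exact MeasurableSet.iInter fun i => measurableSet_le (by fun_prop) measurable_const

/-- The features of round `t` may be integrated out conditionally on the past. -/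
theorem lintegral_ctx [IsProbabilityMeasure P] {F : Type*} [MeasurableSpace F] {t : ℕ} {g : Ω → F}
    (hg : Measurable[B.past t] g) {f : F → Contexts d → ℝ≥0∞}
    (hf : Measurable (Function.uncurry f)) :
    ∫⁻ ω, f (g ω) (B.ctx t ω) ∂P = ∫⁻ ω, ∫⁻ x, f (g ω) x ∂B.law ∂P := by
  rw [lintegral_comp_of_indep (hB.past_le t) (hB.measurable_ctx t) (hB.ctx_indep t) hg hf,
    hB.ctx_law t]

/-- The features and the coin of round `t` may be integrated out conditionally on the past. -/
theorem lintegral_ctx_coin [IsProbabilityMeasure P] {F : Type*} [MeasurableSpace F] {t : ℕ} {g : Ω → F}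
    (hg : Measurable[B.past t] g) {f : F → Contexts d × Fin 2 → ℝ≥0∞}
    (hf : Measurable (Function.uncurry f)) :
    ∫⁻ ω, f (g ω) (B.ctx t ω, B.coin t ω) ∂P =
      ∫⁻ ω, ∫⁻ z, f (g ω) z ∂(B.law.prod fairCoin) ∂P := by
  have := hB.isProbabilityMeasure_law
  have hf' : Measurable fun p : (F × Contexts d) × Fin 2 => f p.1.1 (p.1.2, p.2) :=
    hf.comp ((measurable_fst.comp measurable_fst).prodMk
      ((measurable_snd.comp measurable_fst).prodMk measurable_snd))
  -- The coin goes first, since it is independent of the past together with the current features;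
  -- the features are then independent of the past.
  have h1 := lintegral_comp_of_indep (hB.pastCtx_le t) (hB.measurable_coin t) (hB.coin_indep t)
    (g := fun ω => (g ω, B.ctx t ω))
    ((hg.mono (B.past_le_pastCtx t) le_rfl).prodMk (B.measurable_ctx_pastCtx t))
    (f := fun p u => f p.1 (p.2, u)) hf'
  rw [h1, hB.map_coin t]
  rw [hB.lintegral_ctx hg (f := fun y x => ∫⁻ u, f y (x, u) ∂fairCoin)
    hf'.lintegral_prod_right']
  refine lintegral_congr fun ω => ?_
  exact (lintegral_prod _ (hf.comp measurable_prodMk_left).aemeasurable).symm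

end GLMBandit.IsModel

/-! ### Concentration -/

/-- Azuma-Hoeffding bound for averages of conditionally sub-Gaussian increments. -/
theorem measureReal_abs_average_ge_le {Ω : Type*} {mΩ : MeasurableSpace Ω} {P : Measure Ω}
    [IsProbabilityMeasure P] {F : ℕ → MeasurableSpace Ω} (hF : ∀ n, F n ≤ mΩ) {Z : ℕ → Ω → ℝ}
    {v : ℝ} (hv : 0 ≤ v)
    (hZ : ∀ n, Measurable[F n] fun ω => ∑ t ∈ Finset.range n, Z t ω)
    (h : ∀ (α : ℝ) t, ∀ W : Ω → ℝ≥0∞, Measurable[F t] W →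
      ∫⁻ ω, W ω * ENNReal.ofReal (Real.exp (α * Z t ω)) ∂P ≤
        ENNReal.ofReal (Real.exp (α ^ 2 * v / 2)) * ∫⁻ ω, W ω ∂P)
    {n : ℕ} (hn : 1 ≤ n) {η : ℝ} (hη : 0 ≤ η) :
    P.real {ω | η ≤ |1 / (n : ℝ) * ∑ t ∈ Finset.range n, Z t ω|} ≤
      2 * Real.exp (-(n * η ^ 2 / (2 * v))) := by
  have hn' : (0 : ℝ) < n := by exact_mod_cast hn
  have hnv : 0 ≤ n * v := by positivity
  have key := measureReal_abs_ge_le (P := P) ((hZ n).mono (hF n) le_rfl)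
    (v := (n * v).toNNReal)
    (fun α => by rw [Real.coe_toNNReal _ hnv]; exact lintegral_exp_sum_le hZ (h α) n)
    (s := n * η) (by positivity)
  have hset : {ω | η ≤ |1 / (n : ℝ) * ∑ t ∈ Finset.range n, Z t ω|} =
      {ω | n * η ≤ |∑ t ∈ Finset.range n, Z t ω|} := by
    ext ω
    simp only [Set.mem_ofPred_eq]
    rw [abs_mul, abs_of_pos (by positivity), one_div, inv_mul_eq_div, le_div_iff₀ hn', mul_comm]
  rw [hset]
  refine key.trans_eq ?_
  congr 2
  rw [Real.coe_toNNReal _ hnv]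
  rcases hv.eq_or_lt with rfl | hv
  · simp
  · field_simp

namespace GLMBandit.IsModel

variable {d : ℕ} {Ω : Type*} [mΩ : MeasurableSpace Ω] {P : Measure Ω} [IsProbabilityMeasure P]
  {B : GLMBandit d Ω} {est : (n : ℕ) → (Fin n → Vec d × ℝ) → Vec d} {σ xmax : ℝ}

/-- The played arm and its features are known before the reward, so on each event `{arm = i}` the
noise of arm `i` is multiplied by a `preReward`-measurable coefficient of size at most `|α| xmax`.
-/
theorem lintegral_exp_noise_le (hB : B.IsModel P σ) (hest : ∀ n, Measurable (est n))
    (hl : Measurable B.link) {t : ℕ} (hX : ∀ᵐ ω ∂P, ∀ i, ‖B.ctx t ω i‖ ≤ xmax) (k : Fin d)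
    (α : ℝ) {W : Ω → ℝ≥0∞} (hW : Measurable[B.past t] W) :
    ∫⁻ ω, W ω * ENNReal.ofReal
        (Real.exp (α * (B.feature est t ω k * B.noise t (B.arm est t ω) ω))) ∂P ≤
      ENNReal.ofReal (Real.exp (α ^ 2 * (xmax ^ 2 * σ ^ 2) / 2)) * ∫⁻ ω, W ω ∂P := by
  have hm := hB.preReward_le t
  have ha := B.measurable_arm_preReward hest hl t
  have hx := B.measurable_ctx_preReward t
  have hA : ∀ i : Fin 2, Measurable[B.preReward t] fun ω => α * B.ctx t ω i k := fun i =>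
    Measurable.const_mul ((by fun_prop : Measurable fun x : Contexts d => x i k).comp hx) α
  let V : Fin 2 → Ω → ℝ≥0∞ := fun i => (B.arm est t ⁻¹' {i}).indicator W
  have hV : ∀ i, Measurable[B.preReward t] (V i) := fun i =>
    (hW.mono (B.past_le_preReward t) le_rfl).indicator (ha (measurableSet_singleton i))
  have hV' : ∀ i, Measurable (V i) := fun i => (hV i).mono hm le_rfl
  have hA' : ∀ i : Fin 2, Measurable fun ω => α * B.ctx t ω i k := fun i => (hA i).mono hm le_rfl
  have hN := hB.measurable_noise t
  have hsplit : ∀ (f : Fin 2 → Ω → ℝ≥0∞) ω,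
      W ω * f (B.arm est t ω) ω = V 0 ω * f 0 ω + V 1 ω * f 1 ω := by
    intro f ω
    obtain h | h : B.arm est t ω = 0 ∨ B.arm est t ω = 1 := by omega
    · simp [V, h]
    · simp [V, h]
  have hstep : ∀ i, ∫⁻ ω, V i ω * ENNReal.ofReal (Real.exp (α * B.ctx t ω i k * B.noise t i ω)) ∂P
      ≤ ENNReal.ofReal (Real.exp (α ^ 2 * (xmax ^ 2 * σ ^ 2) / 2)) * ∫⁻ ω, V i ω ∂P := by
    intro i
    refine (lintegral_mul_exp_mul_le_of_condExp_le hm (hN i) (hB.noise_integrable_exp t i)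
      (hB.noise_subGaussian t i) (hA i) (hV i)).trans ?_
    rw [← lintegral_const_mul _ (hV' i)]
    refine lintegral_mono_ae (hX.mono fun ω hω => ?_)
    rw [mul_comm]
    refine mul_le_mul_left (ENNReal.ofReal_le_ofReal (Real.exp_le_exp.2 ?_)) _
    have := abs_mul_apply_le_sq (hω i) k k
    rw [← sq, abs_of_nonneg (sq_nonneg _)] at this
    calc (α * B.ctx t ω i k) ^ 2 * σ ^ 2 / 2 = α ^ 2 * ((B.ctx t ω i k) ^ 2 * σ ^ 2) / 2 := by
          ring
      _ ≤ _ := by gcongr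
  calc ∫⁻ ω, W ω * ENNReal.ofReal
        (Real.exp (α * (B.feature est t ω k * B.noise t (B.arm est t ω) ω))) ∂P
      = ∫⁻ ω, (V 0 ω * ENNReal.ofReal (Real.exp (α * B.ctx t ω 0 k * B.noise t 0 ω)) +
          V 1 ω * ENNReal.ofReal (Real.exp (α * B.ctx t ω 1 k * B.noise t 1 ω))) ∂P := by
        refine lintegral_congr fun ω => ?_
        rw [← hsplit (fun i ω => ENNReal.ofReal
          (Real.exp (α * B.ctx t ω i k * B.noise t i ω))) ω, mul_assoc]
        rfl
    _ = _ := lintegral_add_left ((hV' 0).mul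
        (((hA' 0).mul (hN 0)).exp.ennreal_ofReal)) _
    _ ≤ _ := add_le_add (hstep 0) (hstep 1)
    _ = _ := by
        rw [← mul_add, ← lintegral_add_left (hV' 0)]
        congr 1
        refine lintegral_congr fun ω => ?_
        simpa using (hsplit (fun _ _ => 1) ω).symm

/-- Given the past the estimate is frozen and the features and coin are fresh, so Hoeffding's lemma
for a fixed `β` applies conditionally. -/
theorem lintegral_exp_gram_le (hB : B.IsModel P σ) (hest : ∀ n, Measurable (est n))
    (hl : Measurable B.link) (hX : ∀ᵐ ω ∂P, ∀ i, ‖B.ctx 0 ω i‖ ≤ xmax) (t : ℕ) (j k : Fin d)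
    (α : ℝ) {W : Ω → ℝ≥0∞} (hW : Measurable[B.past t] W) :
    ∫⁻ ω, W ω * ENNReal.ofReal (Real.exp (α * (B.feature est t ω j * B.feature est t ω k -
        greedyGram B.law (B.estimate est t ω) j k))) ∂P ≤
      ENNReal.ofReal (Real.exp (α ^ 2 * (xmax ^ 2) ^ 2 / 2)) * ∫⁻ ω, W ω ∂P := by
  have := hB.isProbabilityMeasure_law
  have hM := measurable_greedyGram B.law j k
  have hG := measurable_greedyFeature (d := d)
  -- The weight is carried along with the estimate as one past-measurable variable, so that both are
  -- frozen when the round is integrated out.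
  have hg := hW.prodMk (B.measurable_estimate hest hl t)
  have hf : Measurable fun p : (ℝ≥0∞ × Vec d) × Contexts d × Fin 2 =>
      ENNReal.ofReal (Real.exp (α * (greedyFeature p.1.2 p.2.1 p.2.2 j *
        greedyFeature p.1.2 p.2.1 p.2.2 k - greedyGram B.law p.1.2 j k))) := by
    have h1 : Measurable fun p : (ℝ≥0∞ × Vec d) × Contexts d × Fin 2 =>
        greedyFeature p.1.2 p.2.1 p.2.2 :=
      hG.comp ((measurable_snd.comp measurable_fst).prodMk measurable_snd)
    have h2 : Measurable fun p : (ℝ≥0∞ × Vec d) × Contexts d × Fin 2 =>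
        greedyGram B.law p.1.2 j k := hM.comp (measurable_snd.comp measurable_fst)
    exact Measurable.ennreal_ofReal (Measurable.exp (Measurable.const_mul
      (Measurable.sub (by fun_prop) h2) α))
  have hf' := (measurable_fst.comp (measurable_fst
    (α := ℝ≥0∞ × Vec d) (β := Contexts d × Fin 2))).mul hf
  calc _ = ∫⁻ ω, ∫⁻ z, W ω * ENNReal.ofReal (Real.exp (α *
            (greedyFeature (B.estimate est t ω) z.1 z.2 j *
              greedyFeature (B.estimate est t ω) z.1 z.2 k -
              greedyGram B.law (B.estimate est t ω) j k))) ∂(B.law.prod fairCoin) ∂P :=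
        hB.lintegral_ctx_coin hg (f := fun y z => y.1 * ENNReal.ofReal (Real.exp (α *
            (greedyFeature y.2 z.1 z.2 j * greedyFeature y.2 z.1 z.2 k -
              greedyGram B.law y.2 j k)))) hf'
    _ ≤ ∫⁻ ω, ENNReal.ofReal (Real.exp (α ^ 2 * (xmax ^ 2) ^ 2 / 2)) * W ω ∂P := by
        have hfω : ∀ β, Measurable fun z : Contexts d × Fin 2 =>
            ENNReal.ofReal (Real.exp (α * (greedyFeature β z.1 z.2 j *
              greedyFeature β z.1 z.2 k - greedyGram B.law β j k))) := fun β => by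
          have := measurable_greedyFeature_left β
          exact Measurable.ennreal_ofReal (Measurable.exp (Measurable.const_mul
            (Measurable.sub_const (by fun_prop) _) α))
        refine lintegral_mono fun ω => (lintegral_const_mul (W ω) (hfω _)).trans_le ?_
        rw [mul_comm]
        exact mul_le_mul_left (lintegral_exp_greedyFeature_le (hB.ae_law hX) _ j k α) _
    _ = _ := lintegral_const_mul _ (hW.mono (hB.past_le t) le_rfl)

theorem measureReal_noise_ge_le (hB : B.IsModel P σ) (hest : ∀ n, Measurable (est n))
    (hl : Measurable B.link) (hX : ∀ t, ∀ᵐ ω ∂P, ∀ i, ‖B.ctx t ω i‖ ≤ xmax) (k : Fin d)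
    {n : ℕ} (hn : 1 ≤ n) {η : ℝ} (hη : 0 ≤ η) :
    P.real {ω | η ≤ |1 / (n : ℝ) * ∑ t ∈ Finset.range n,
        B.feature est t ω k * B.noise t (B.arm est t ω) ω|} ≤
      2 * Real.exp (-(n * η ^ 2 / (2 * (xmax ^ 2 * σ ^ 2)))) := by
  refine measureReal_abs_average_ge_le (F := B.past) hB.past_le (by positivity) (fun n => ?_)
    (fun α t W hW => hB.lintegral_exp_noise_le hest hl (hX t) k α hW) hn hη
  refine Finset.measurable_fun_sum _ fun t ht => ?_
  have ht := Finset.mem_range.1 ht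
  have hk : Measurable fun x : Vec d => x k := by fun_prop
  exact (hk.comp (B.measurable_feature_past hest hl ht)).mul
    (measurable_apply_fin_two (f := fun ω i => B.noise t i ω) (B.measurable_noise_past ht)
      (B.measurable_arm_past hest hl ht))

theorem measureReal_gram_ge_le (hB : B.IsModel P σ) (hest : ∀ n, Measurable (est n))
    (hl : Measurable B.link) (hX : ∀ᵐ ω ∂P, ∀ i, ‖B.ctx 0 ω i‖ ≤ xmax) (j k : Fin d)
    {n : ℕ} (hn : 1 ≤ n) {η : ℝ} (hη : 0 ≤ η) :
    P.real {ω | η ≤ |1 / (n : ℝ) * ∑ t ∈ Finset.range n,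
        (B.feature est t ω j * B.feature est t ω k -
          greedyGram B.law (B.estimate est t ω) j k)|} ≤
      2 * Real.exp (-(n * η ^ 2 / (2 * (xmax ^ 2) ^ 2))) := by
  have := hB.isProbabilityMeasure_law
  refine measureReal_abs_average_ge_le (F := B.past) hB.past_le (by positivity) (fun n => ?_)
    (fun α t W hW => hB.lintegral_exp_gram_le hest hl hX t j k α hW) hn hη
  refine Finset.measurable_fun_sum _ fun t ht => ?_
  have ht := Finset.mem_range.1 ht
  have hk : ∀ k, Measurable fun x : Vec d => x k := fun k => by fun_prop
  have hF := B.measurable_feature_past hest hl ht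
  exact (((hk j).comp hF).mul ((hk k).comp hF)).sub ((measurable_greedyGram B.law j k).comp
    ((B.measurable_estimate hest hl t).mono (B.past_mono ht.le) le_rfl))

end GLMBandit.IsModel

/-! ### The prediction error of the estimates -/

/-- `δᵀΣδ` for the error `δ = β - β*`. -/
noncomputable def GLMBandit.predError {d : ℕ} {Ω : Type*} (B : GLMBandit d Ω) (β : Vec d) : ℝ :=
  (β - B.param).ofLp ⬝ᵥ (gramMatrix B.law).mulVec (β - B.param).ofLp

theorem measurable_dotProduct_mulVec {d : ℕ} (M : Matrix (Fin d) (Fin d) ℝ) :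
    Measurable fun v : Vec d => v.ofLp ⬝ᵥ M.mulVec v.ofLp := by
  simp only [dotProduct_mulVec_eq_sum]
  fun_prop

theorem dotProduct_smul_sum_mulVec {ι : Type*} {d : ℕ} (s : Finset ι) (c : ℝ)
    (A : ι → Matrix (Fin d) (Fin d) ℝ) (v : Vec d) :
    v.ofLp ⬝ᵥ (Matrix.of fun j k => c * ∑ t ∈ s, A t j k).mulVec v.ofLp =
      c * ∑ t ∈ s, v.ofLp ⬝ᵥ (A t).mulVec v.ofLp := by
  simp only [dotProduct_mulVec_eq_sum, Matrix.of_apply, Finset.mul_sum, Finset.sum_mul, mul_assoc]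
  rw [Finset.sum_comm (s := s)]
  exact Finset.sum_congr rfl fun j _ => Finset.sum_comm

theorem regParam_pos {lam0 : ℝ} (h : 0 < lam0) {d n : ℕ} (hn : 2 ≤ n) :
    0 < regParam lam0 d n := by
  have h1 : 0 < Real.log n := Real.log_pos (by exact_mod_cast hn)
  have h2 : 0 ≤ Real.log d := Real.log_natCast_nonneg d
  have h3 : (0 : ℝ) < n := by positivity
  exact mul_pos h (Real.sqrt_pos.2 (by positivity))

namespace GLMBandit.Regular

variable {d : ℕ} {Ω : Type*} [mΩ : MeasurableSpace Ω] {P : Measure Ω} [IsProbabilityMeasure P]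
  {B : GLMBandit d Ω} {est : (n : ℕ) → (Fin n → Vec d × ℝ) → Vec d}
  {σ xmax b κ₀ κ₁ φ₀ ν lam0 : ℝ}

/-- If the noise is dominated by the penalty and the empirical Gram matrix is close to its
compensator, then the prediction error is small. -/
theorem predError_estimate_le (hR : B.Regular P xmax b κ₀ κ₁ φ₀ ν) (hB : B.IsModel P σ)
    (hE : IsLassoEstimator B.cumulant lam0 est) (hκ₀ : 0 < κ₀) (hφ₀ : 0 < φ₀)
    (hs : 1 ≤ sparsity B.param) {n : ℕ} (hn : 1 ≤ n) (hlam : 0 < regParam lam0 d n) {ω : Ω}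
    (hnoise : ∀ k, |1 / (n : ℝ) * ∑ t ∈ Finset.range n,
      B.feature est t ω k * B.noise t (B.arm est t ω) ω| ≤ regParam lam0 d n / 2)
    (hgram : ∀ j k, |1 / (n : ℝ) * ∑ t ∈ Finset.range n,
      (B.feature est t ω j * B.feature est t ω k -
        greedyGram B.law (B.estimate est t ω) j k)| ≤ φ₀ ^ 2 / (64 * sparsity B.param * ν)) :
    B.predError (B.estimate est n ω) ≤
      4 * ν ^ 2 * regParam lam0 d n ^ 2 * sparsity B.param / (κ₀ ^ 2 * φ₀ ^ 2) := by
  have := hB.isProbabilityMeasure_law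
  have hn' : (0 : ℝ) < n := by exact_mod_cast hn
  have hK := hB.ae_law (hR.norm_ctx_le 0)
  have hν : 0 < ν := zero_lt_one.trans_le (B.one_le_of_relaxed_symmetry hR.relaxed_symmetry)
  set v := B.estimate est n ω - B.param
  let G : Matrix (Fin d) (Fin d) ℝ := Matrix.of fun j k =>
    1 / (n : ℝ) * ∑ t ∈ Finset.range n, B.feature est t ω j * B.feature est t ω k
  let M : Matrix (Fin d) (Fin d) ℝ := Matrix.of fun j k =>
    1 / (n : ℝ) * ∑ t ∈ Finset.range n, greedyGram B.law (B.estimate est t ω) j k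
  have hGv : v.ofLp ⬝ᵥ G.mulVec v.ofLp =
      1 / (n : ℝ) * ∑ t ∈ Finset.range n, inner ℝ (B.feature est t ω) v ^ 2 := by
    refine (dotProduct_smul_sum_mulVec _ _
      (fun t => Matrix.of fun j k => B.feature est t ω j * B.feature est t ω k) v).trans ?_
    simp only [dotProduct_mulVec_eq_sum, inner_sq_eq_sum, Matrix.of_apply]
  have hMv : v.ofLp ⬝ᵥ M.mulVec v.ofLp = 1 / (n : ℝ) * ∑ t ∈ Finset.range n,
      v.ofLp ⬝ᵥ (greedyGram B.law (B.estimate est t ω)).mulVec v.ofLp :=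
    dotProduct_smul_sum_mulVec _ _ (fun t => greedyGram B.law (B.estimate est t ω)) v
  refine quadratic_le_of_compatibility (A := gramMatrix B.law) (M := M) (G := G)
    (S := activeSet B.param) hs hφ₀ hν hκ₀ hlam hR.compatibility ?_ ?_ ?_ ?_
  · rw [hGv]; positivity
  · rw [hMv, mul_left_comm, Finset.mul_sum]
    calc v.ofLp ⬝ᵥ (gramMatrix B.law).mulVec v.ofLp = 1 / (n : ℝ) * ∑ t ∈ Finset.range n,
          v.ofLp ⬝ᵥ (gramMatrix B.law).mulVec v.ofLp := by
          rw [Finset.sum_const, Finset.card_range, nsmul_eq_mul]; field_simp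
      _ ≤ _ := by
          gcongr with t ht
          exact B.gramMatrix_le_greedyGram hB.measurable_density hR.relaxed_symmetry hK _ v
  · intro j k
    have := hgram j k
    rw [Finset.sum_sub_distrib, mul_sub] at this
    exact this
  · have hb := lasso_basic_inequality (n := n) (D := B.history est ω n)
      (β := B.estimate est n ω) (γ := B.param) hlam.le hB.hasDerivAt_cumulant
      hR.differentiable_link (fun z => (hR.deriv_link z).1) (hE.isMin n hn _) ?_
    · simp only [history_apply] at hb
      rw [hGv, Finset.sum_range]
      exact hb
    · intro k
      have := hnoise k
      rw [Finset.sum_range] at this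
      simp only [history_apply, reward]
      convert! this using 6
      exact add_sub_cancel_left _ _

/-- Tail bound for the prediction error. -/
theorem measureReal_predError_gt_le (hR : B.Regular P xmax b κ₀ κ₁ φ₀ ν) (hB : B.IsModel P σ)
    (hE : IsLassoEstimator B.cumulant (2 * σ * xmax) est) (hσ : 0 < σ) (hxmax : 0 < xmax)
    (hκ₀ : 0 < κ₀) (hφ₀ : 0 < φ₀) (hs : 1 ≤ sparsity B.param) (hd : 1 ≤ d) {n : ℕ} (hn : 2 ≤ n) :
    P.real {ω | 4 * ν ^ 2 * regParam (2 * σ * xmax) d n ^ 2 * sparsity B.param /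
        (κ₀ ^ 2 * φ₀ ^ 2) < B.predError (B.estimate est n ω)} ≤
      2 / n ^ 2 +
        2 * d ^ 2 * Real.exp (-(8 * C0 φ₀ ν xmax (sparsity B.param) ^ 2 * n)) := by
  have := hB.isProbabilityMeasure_law
  have hl : Measurable B.link := hR.differentiable_link.continuous.measurable
  have hν : 0 < ν := zero_lt_one.trans_le (B.one_le_of_relaxed_symmetry hR.relaxed_symmetry)
  have hs' : (0 : ℝ) < sparsity B.param := by exact_mod_cast hs
  have hd' : (0 : ℝ) < d := by exact_mod_cast hd
  have hn' : (0 : ℝ) < n := by positivity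
  have hlam : 0 < regParam (2 * σ * xmax) d n := regParam_pos (by positivity) hn
  set lam := regParam (2 * σ * xmax) d n with hlam_def
  set s : ℝ := (sparsity B.param : ℝ)
  set η : ℝ := φ₀ ^ 2 / (64 * s * ν) with hη
  let N : Fin d → Set Ω := fun k => {ω | lam / 2 ≤ |1 / (n : ℝ) * ∑ t ∈ Finset.range n,
    B.feature est t ω k * B.noise t (B.arm est t ω) ω|}
  let G : Fin d × Fin d → Set Ω := fun p => {ω | η ≤ |1 / (n : ℝ) * ∑ t ∈ Finset.range n,
    (B.feature est t ω p.1 * B.feature est t ω p.2 -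
      greedyGram B.law (B.estimate est t ω) p.1 p.2)|}
  have hsub : {ω | 4 * ν ^ 2 * lam ^ 2 * s / (κ₀ ^ 2 * φ₀ ^ 2) <
      B.predError (B.estimate est n ω)} ⊆ (⋃ k, N k) ∪ ⋃ p, G p := by
    intro ω hω
    by_contra! hc
    rw [Set.mem_ofPred_eq] at hω
    simp only [Set.mem_union, Set.mem_iUnion, not_or, not_exists] at hc
    refine absurd hω (not_lt.2 ?_)
    exact hR.predError_estimate_le hB hE hκ₀ hφ₀ hs (by omega) hlam
      (fun k => (not_le.1 (hc.1 k)).le) (fun j k => (not_le.1 (hc.2 (j, k))).le)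
  -- With `λ₀ = 2σ xmax` the Azuma exponent is exactly `2 log n + log d`; the union over `d`
  -- coordinates then leaves `2 / n²`.
  have hN : ∀ k, P.real (N k) ≤ 2 / (d * n ^ 2) := by
    intro k
    refine (hB.measureReal_noise_ge_le hE.measurable hl hR.norm_ctx_le k (by omega)
      (by positivity)).trans_eq ?_
    have h1 : 0 ≤ (4 * Real.log n + 2 * Real.log d) / n := by
      have := Real.log_natCast_nonneg n
      have := Real.log_natCast_nonneg d
      positivity
    have h2 : lam ^ 2 = (2 * σ * xmax) ^ 2 * ((4 * Real.log n + 2 * Real.log d) / n) := by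
      rw [hlam_def, regParam, mul_pow, Real.sq_sqrt h1]
    have h3 : n * (lam / 2) ^ 2 / (2 * (xmax ^ 2 * σ ^ 2)) = Real.log (d * n ^ 2) := by
      rw [div_pow, h2, Real.log_mul hd'.ne' (by positivity), Real.log_pow]
      field_simp
      push_cast
      ring
    rw [h3, Real.exp_neg, Real.exp_log (by positivity), div_eq_mul_inv]
  have hG : ∀ p, P.real (G p) ≤
      2 * Real.exp (-(8 * C0 φ₀ ν xmax (sparsity B.param) ^ 2 * n)) := by
    intro p
    refine (hB.measureReal_gram_ge_le hE.measurable hl (hR.norm_ctx_le 0) p.1 p.2 (by omega)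
      (by positivity)).trans ?_
    gcongr 2 * Real.exp (-?_)
    have h0 : 0 ≤ C0 φ₀ ν xmax (sparsity B.param) := le_min (by norm_num) (by positivity)
    have h1 : C0 φ₀ ν xmax (sparsity B.param) ≤ φ₀ ^ 2 / (256 * s * ν * xmax ^ 2) :=
      min_le_right _ _
    -- Since `256 = 4 · 64`, the exponent `n η² / (2 xmax⁴)` is `8 n` times the square of the second
    -- entry in the minimum defining `C0`.
    calc 8 * C0 φ₀ ν xmax (sparsity B.param) ^ 2 * n
        ≤ 8 * (φ₀ ^ 2 / (256 * s * ν * xmax ^ 2)) ^ 2 * n := by gcongr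
      _ = _ := by rw [hη]; field_simp; norm_num
  calc _ ≤ P.real ((⋃ k, N k) ∪ ⋃ p, G p) := measureReal_mono hsub
    _ ≤ P.real (⋃ k, N k) + P.real (⋃ p, G p) := measureReal_union_le _ _
    _ ≤ ∑ k, P.real (N k) + ∑ p, P.real (G p) :=
        add_le_add (measureReal_iUnion_fintype_le _) (measureReal_iUnion_fintype_le _)
    _ ≤ ∑ _k : Fin d, 2 / ((d : ℝ) * n ^ 2) + ∑ _p : Fin d × Fin d,
          2 * Real.exp (-(8 * C0 φ₀ ν xmax (sparsity B.param) ^ 2 * n)) :=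
        add_le_add (Finset.sum_le_sum fun k _ => hN k) (Finset.sum_le_sum fun p _ => hG p)
    _ = _ := by
        simp only [Finset.sum_const, Finset.card_univ, Fintype.card_prod, Fintype.card_fin,
          nsmul_eq_mul]
        push_cast
        congr 1
        · field_simp
        · ring

end GLMBandit.Regular

/-! ### The regret of one round -/

theorem inner_le_inner_greedyArm {d : ℕ} (β : Vec d) (x : Contexts d) (u i : Fin 2) :
    inner ℝ (x i) β ≤ inner ℝ (x (greedyArm β x u)) β := by
  unfold greedyArm
  split_ifs with h1 h2
  · obtain rfl | rfl : i = 0 ∨ i = 1 := by omega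
    · exact h1.le
    · exact le_rfl
  · obtain rfl | rfl : i = 0 ∨ i = 1 := by omega
    · exact le_rfl
    · exact h2.le
  · have h : inner ℝ (x 0) β = inner ℝ (x 1) β := le_antisymm (not_lt.1 h2) (not_lt.1 h1)
    have h' : ∀ k, inner ℝ (x k) β = inner ℝ (x 0) β := fun k => by
      obtain rfl | rfl : k = 0 ∨ k = 1 := by omega
      · rfl
      · exact h.symm
    rw [h' i, h' u]

/-- For `a ≤ b` the left side is nonpositive because `κ₀ ≥ 0` makes the link monotone; otherwise the
mean value inequality applies. -/
theorem image_sub_le_mul_max {μ : ℝ → ℝ} {κ₀ κ₁ : ℝ} (hκ₀ : 0 ≤ κ₀) (hd : Differentiable ℝ μ)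
    (h : ∀ z, κ₀ ≤ deriv μ z ∧ deriv μ z ≤ κ₁) (a b : ℝ) : μ a - μ b ≤ κ₁ * max (a - b) 0 := by
  have hκ₁ : 0 ≤ κ₁ := hκ₀.trans ((h 0).1.trans (h 0).2)
  rcases le_total b a with hab | hab
  · exact (image_sub_le_mul_sub_of_deriv_le hd (fun z => (h z).2) hab).trans
      (mul_le_mul_of_nonneg_left (le_max_left _ _) hκ₁)
  · have := mul_sub_le_image_sub_of_le_deriv hd (fun z => (h z).1) hab
    have h1 : 0 ≤ κ₀ * (b - a) := mul_nonneg hκ₀ (sub_nonneg.2 hab)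
    have h2 : 0 ≤ κ₁ * max (a - b) 0 := mul_nonneg hκ₁ (le_max_right _ _)
    linarith

theorem abs_inner_sub_eq {d : ℕ} (x : Contexts d) (v : Vec d) {i j : Fin 2} (h : i ≠ j) :
    |inner ℝ (x i - x j) v| = |inner ℝ (x 0 - x 1) v| := by
  obtain ⟨rfl, rfl⟩ | ⟨rfl, rfl⟩ : (i = 0 ∧ j = 1) ∨ (i = 1 ∧ j = 0) := by omega
  · rfl
  · rw [← neg_sub, inner_neg_left, abs_neg]

/-- Splits a regret into a bad event and a linearized square root: `k q + (k / (4q)) · 4q² = 2 k q`,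
which replaces a conditional Cauchy–Schwarz inequality. -/
theorem integral_le_of_le_indicator_add {Ω : Type*} {mΩ : MeasurableSpace Ω} {P : Measure Ω}
    [IsProbabilityMeasure P] {f : Ω → ℝ} (hf : Integrable f P) (hf0 : ∀ ω, 0 ≤ f ω) {s : Set Ω}
    (hs : MeasurableSet s) {c k q : ℝ} (hc : 0 ≤ c) (hk : 0 ≤ k) (hq : 0 < q) {H : Ω → ℝ≥0∞}
    (hH : Measurable H) (hHq : ∫⁻ ω, H ω ∂P ≤ ENNReal.ofReal (4 * q ^ 2))
    (h : ∀ᵐ ω ∂P, ENNReal.ofReal (f ω) ≤ s.indicator (fun _ => ENNReal.ofReal c) ω +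
      (ENNReal.ofReal (k * q) + ENNReal.ofReal (k / (4 * q)) * H ω)) :
    ∫ ω, f ω ∂P ≤ c * P.real s + 2 * k * q := by
  have hfin : ∫⁻ ω, ENNReal.ofReal (f ω) ∂P ≤ ENNReal.ofReal (c * P.real s + 2 * k * q) := by
    calc _ ≤ _ := lintegral_mono_ae h
      _ = ENNReal.ofReal c * P s + (ENNReal.ofReal (k * q) + ENNReal.ofReal (k / (4 * q)) *
            ∫⁻ ω, H ω ∂P) := by
          rw [lintegral_add_left (measurable_const.indicator hs),
            lintegral_indicator_const hs, lintegral_add_left measurable_const,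
            lintegral_const, measure_univ, mul_one, lintegral_const_mul _ hH]
      _ ≤ ENNReal.ofReal c * P s + (ENNReal.ofReal (k * q) +
          ENNReal.ofReal (k / (4 * q)) * ENNReal.ofReal (4 * q ^ 2)) := by gcongr
      _ = _ := by
          rw [← ofReal_measureReal, ← ENNReal.ofReal_mul (by positivity),
            ← ENNReal.ofReal_mul (by positivity), ← ENNReal.ofReal_add (by positivity)
            (by positivity), ← ENNReal.ofReal_add (by positivity) (by positivity)]
          congr 1
          field_simp
          ring
  rw [← ofReal_integral_eq_lintegral_ofReal hf (ae_of_all _ hf0),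
    ENNReal.ofReal_le_ofReal_iff (by positivity)] at hfin
  exact hfin

namespace GLMBandit

theorem instantRegret_nonneg {d : ℕ} {Ω : Type*} (B : GLMBandit d Ω)
    (est : (n : ℕ) → (Fin n → Vec d × ℝ) → Vec d) (t : ℕ) (ω : Ω) : 0 ≤ B.instantRegret est t ω := by
  unfold instantRegret
  rw [sub_nonneg]
  obtain h | h : B.arm est t ω = 0 ∨ B.arm est t ω = 1 := by omega
  · rw [h]; exact le_max_left _ _
  · rw [h]; exact le_max_right _ _

theorem instantRegret_le_of_forall {d : ℕ} {Ω : Type*} {B : GLMBandit d Ω}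
    {est : (n : ℕ) → (Fin n → Vec d × ℝ) → Vec d} {t : ℕ} {ω : Ω} {c : ℝ}
    (h : ∀ i, B.link (inner ℝ (B.ctx t ω i) B.param) -
      B.link (inner ℝ (B.ctx t ω (B.arm est t ω)) B.param) ≤ c) :
    B.instantRegret est t ω ≤ c := by
  unfold instantRegret
  rw [sub_le_iff_le_add]
  exact max_le (by linarith [h 0]) (by linarith [h 1])

end GLMBandit

namespace GLMBandit.Regular

variable {d : ℕ} {Ω : Type*} [mΩ : MeasurableSpace Ω] {P : Measure Ω}
  {B : GLMBandit d Ω} {est : (n : ℕ) → (Fin n → Vec d × ℝ) → Vec d}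
  {σ xmax b κ₀ κ₁ φ₀ ν : ℝ}

theorem kappa_one_nonneg (hR : B.Regular P xmax b κ₀ κ₁ φ₀ ν) (hκ₀ : 0 < κ₀) : 0 ≤ κ₁ :=
  hκ₀.le.trans ((hR.deriv_link 0).1.trans (hR.deriv_link 0).2)

theorem instantRegret_le_param (hR : B.Regular P xmax b κ₀ κ₁ φ₀ ν) (hκ₀ : 0 < κ₀) (t : ℕ) (ω : Ω) :
    B.instantRegret est t ω ≤ κ₁ * |inner ℝ (B.ctx t ω 0 - B.ctx t ω 1) B.param| := by
  have hκ₁ := hR.kappa_one_nonneg hκ₀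
  refine instantRegret_le_of_forall fun i => ?_
  refine (image_sub_le_mul_max hκ₀.le hR.differentiable_link hR.deriv_link _ _).trans
    (mul_le_mul_of_nonneg_left (max_le ?_ (abs_nonneg _)) hκ₁)
  by_cases h : i = B.arm est t ω
  · rw [← h, sub_self]; exact abs_nonneg _
  · rw [← abs_inner_sub_eq _ _ h, inner_sub_left]
    exact le_abs_self _

/-- A better arm `i` has `⟨X_i - X_a, β̂⟩ ≤ 0` by greediness, so its advantage under `β*` can only
come from the estimation error. -/
theorem instantRegret_le_error (hR : B.Regular P xmax b κ₀ κ₁ φ₀ ν) (hκ₀ : 0 < κ₀) (t : ℕ) (ω : Ω) :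
    B.instantRegret est t ω ≤
      κ₁ * |inner ℝ (B.ctx t ω 0 - B.ctx t ω 1) (B.estimate est t ω - B.param)| := by
  have hκ₁ := hR.kappa_one_nonneg hκ₀
  refine instantRegret_le_of_forall fun i => ?_
  refine (image_sub_le_mul_max hκ₀.le hR.differentiable_link hR.deriv_link _ _).trans
    (mul_le_mul_of_nonneg_left (max_le ?_ (abs_nonneg _)) hκ₁)
  by_cases h : i = B.arm est t ω
  · rw [← h, sub_self]; exact abs_nonneg _
  · have hg := inner_le_inner_greedyArm (B.estimate est t ω) (B.ctx t ω) (B.coin t ω) i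
    rw [← abs_inner_sub_eq _ _ h, inner_sub_left, inner_sub_right, inner_sub_right]
    refine le_trans ?_ (neg_le_abs _)
    have hg' : inner ℝ (B.ctx t ω i) (B.estimate est t ω) ≤
      inner ℝ (B.ctx t ω (B.arm est t ω)) (B.estimate est t ω) := hg
    linarith

theorem ae_instantRegret_le (hR : B.Regular P xmax b κ₀ κ₁ φ₀ ν) (hκ₀ : 0 < κ₀) (hxmax : 0 < xmax)
    (t : ℕ) : ∀ᵐ ω ∂P, B.instantRegret est t ω ≤ 2 * κ₁ * xmax * b := by
  have hκ₁ := hR.kappa_one_nonneg hκ₀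
  filter_upwards [hR.norm_ctx_le t] with ω hω
  calc B.instantRegret est t ω ≤ κ₁ * |inner ℝ (B.ctx t ω 0 - B.ctx t ω 1) B.param| :=
        hR.instantRegret_le_param hκ₀ t ω
    _ ≤ κ₁ * (‖B.ctx t ω 0 - B.ctx t ω 1‖ * ‖B.param‖) := by
        gcongr; exact abs_real_inner_le_norm _ _
    _ ≤ κ₁ * ((xmax + xmax) * b) := by
        gcongr
        · exact (norm_sub_le _ _).trans (add_le_add (hω 0) (hω 1))
        · exact hR.norm_param_le
    _ = _ := by ring

theorem measurable_instantRegret (hR : B.Regular P xmax b κ₀ κ₁ φ₀ ν) (hB : B.IsModel P σ)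
    (hest : ∀ n, Measurable (est n)) (t : ℕ) : Measurable (B.instantRegret est t) := by
  have hl : Measurable B.link := hR.differentiable_link.continuous.measurable
  have hx := hB.measurable_ctx t
  have ha : Measurable (B.arm est t) :=
    (B.measurable_arm_preReward hest hl t).mono (hB.preReward_le t) le_rfl
  have hi : ∀ i, Measurable fun ω => B.link (inner ℝ (B.ctx t ω i) B.param) := fun i =>
    hl.comp (by fun_prop)
  exact ((hi 0).max (hi 1)).sub (measurable_apply_fin_two
    (f := fun ω i => B.link (inner ℝ (B.ctx t ω i) B.param)) hi ha)

variable [IsProbabilityMeasure P]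

theorem integrable_instantRegret (hR : B.Regular P xmax b κ₀ κ₁ φ₀ ν) (hB : B.IsModel P σ)
    (hest : ∀ n, Measurable (est n)) (hκ₀ : 0 < κ₀) (hxmax : 0 < xmax) (t : ℕ) :
    Integrable (B.instantRegret est t) P :=
  Integrable.of_bound (hR.measurable_instantRegret hB hest t).aestronglyMeasurable
    (2 * κ₁ * xmax * b) ((hR.ae_instantRegret_le hκ₀ hxmax t).mono fun ω hω => by
      rwa [Real.norm_of_nonneg (B.instantRegret_nonneg est t ω)])

theorem integral_instantRegret_le_const (hR : B.Regular P xmax b κ₀ κ₁ φ₀ ν) (hB : B.IsModel P σ)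
    (hest : ∀ n, Measurable (est n)) (hκ₀ : 0 < κ₀) (hxmax : 0 < xmax) (t : ℕ) :
    ∫ ω, B.instantRegret est t ω ∂P ≤ 2 * κ₁ * xmax * b := by
  have := integral_mono_ae (hR.integrable_instantRegret hB hest hκ₀ hxmax t)
    (integrable_const _) (hR.ae_instantRegret_le hκ₀ hxmax t)
  simpa using this

/-- From `(a - b)² ≤ 2 (a² + b²)` and the factor `1/2` in the definition of `Σ`. -/
theorem lintegral_inner_sub_sq_le (hR : B.Regular P xmax b κ₀ κ₁ φ₀ ν) (hB : B.IsModel P σ)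
    (β : Vec d) :
    ∫⁻ x : Contexts d, ENNReal.ofReal (inner ℝ (x 0 - x 1) (β - B.param) ^ 2) ∂B.law ≤
      ENNReal.ofReal (4 * B.predError β) := by
  have := hB.isProbabilityMeasure_law
  have hK := hB.ae_law (hR.norm_ctx_le 0)
  set v := β - B.param
  have hint : ∀ i : Fin 2, Integrable (fun x : Contexts d => inner ℝ (x i) v ^ 2) B.law :=
    fun i => Integrable.of_bound (Measurable.aestronglyMeasurable (by fun_prop))
      ((xmax * ‖v‖) ^ 2) (hK.mono fun x hx => by
        rw [norm_pow]
        have := (norm_inner_le_norm (𝕜 := ℝ) (x i) v).trans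
          (mul_le_mul_of_nonneg_right (hx i) (norm_nonneg v))
        gcongr)
  have hq : 4 * B.predError β =
      ∫ x, 2 * (inner ℝ (x 0) v ^ 2 + inner ℝ (x 1) v ^ 2) ∂B.law := by
    rw [integral_const_mul, integral_add (hint 0) (hint 1), predError,
      dotProduct_gramMatrix_mulVec hK, Fin.sum_univ_two]
    ring
  have hi : Integrable (fun x : Contexts d =>
      2 * (inner ℝ (x 0) v ^ 2 + inner ℝ (x 1) v ^ 2)) B.law :=
    ((hint 0).add (hint 1)).const_mul 2
  rw [hq, ofReal_integral_eq_lintegral_ofReal hi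
    (ae_of_all _ fun x => by positivity)]
  refine lintegral_mono fun x => ENNReal.ofReal_le_ofReal ?_
  rw [inner_sub_left]
  nlinarith [sq_nonneg (inner ℝ (x 0) v + inner ℝ (x 1) v)]

/-- The expected regret of a round in terms of the prediction error of its estimate. -/
theorem integral_instantRegret_le (hR : B.Regular P xmax b κ₀ κ₁ φ₀ ν) (hB : B.IsModel P σ)
    (hest : ∀ n, Measurable (est n)) (hκ₀ : 0 < κ₀) (hxmax : 0 < xmax) (hb : 0 < b) (t : ℕ)
    {q : ℝ} (hq : 0 < q) :
    ∫ ω, B.instantRegret est t ω ∂P ≤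
      2 * κ₁ * xmax * b * P.real {ω | q ^ 2 < B.predError (B.estimate est t ω)} +
        2 * κ₁ * q := by
  have hκ₁ := hR.kappa_one_nonneg hκ₀
  have hl : Measurable B.link := hR.differentiable_link.continuous.measurable
  have he := B.measurable_estimate hest hl t
  have hpe : Measurable B.predError :=
    (measurable_dotProduct_mulVec _).comp (measurable_id.sub_const _)
  have hbad : MeasurableSet {ω | q ^ 2 < B.predError (B.estimate est t ω)} :=
    measurableSet_lt measurable_const (hpe.comp (he.mono (hB.past_le t) le_rfl))
  set bad := {ω | q ^ 2 < B.predError (B.estimate est t ω)} with hbad_def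
  -- The truncation depends only on the past estimate, so it survives integrating out the current
  -- features and keeps the second moment below `4 q²`.
  let h : Vec d → Contexts d → ℝ≥0∞ := fun β x =>
    if B.predError β ≤ q ^ 2 then ENNReal.ofReal (inner ℝ (x 0 - x 1) (β - B.param) ^ 2) else 0
  have hh : Measurable (Function.uncurry h) :=
    Measurable.ite (measurableSet_le (hpe.comp measurable_fst) measurable_const)
      (by fun_prop) measurable_const
  have hh_le : ∫⁻ ω, h (B.estimate est t ω) (B.ctx t ω) ∂P ≤ ENNReal.ofReal (4 * q ^ 2) := by
    rw [hB.lintegral_ctx he hh]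
    calc _ ≤ ∫⁻ _, ENNReal.ofReal (4 * q ^ 2) ∂P := by
          refine lintegral_mono fun ω => ?_
          by_cases hω : B.predError (B.estimate est t ω) ≤ q ^ 2
          · simp only [h, if_pos hω]
            refine (hR.lintegral_inner_sub_sq_le hB _).trans (ENNReal.ofReal_le_ofReal ?_)
            linarith
          · simp [h, hω]
      _ = _ := by simp
  have hpt : ∀ᵐ ω ∂P, ENNReal.ofReal (B.instantRegret est t ω) ≤
      bad.indicator (fun _ => ENNReal.ofReal (2 * κ₁ * xmax * b)) ω +
        (ENNReal.ofReal (κ₁ * q) +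
          ENNReal.ofReal (κ₁ / (4 * q)) * h (B.estimate est t ω) (B.ctx t ω)) := by
    filter_upwards [hR.ae_instantRegret_le (est := est) hκ₀ hxmax t] with ω hω
    by_cases hω' : ω ∈ bad
    · rw [Set.indicator_of_mem hω']
      exact (ENNReal.ofReal_le_ofReal hω).trans le_self_add
    · have hle : B.predError (B.estimate est t ω) ≤ q ^ 2 := by
        rw [hbad_def, Set.mem_ofPred_eq, not_lt] at hω'
        exact hω'
      rw [Set.indicator_of_notMem hω', zero_add]
      simp only [h, if_pos hle]
      rw [← ENNReal.ofReal_mul (by positivity), ← ENNReal.ofReal_add (by positivity)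
        (by positivity)]
      refine ENNReal.ofReal_le_ofReal ((hR.instantRegret_le_error hκ₀ t ω).trans ?_)
      set D := inner ℝ (B.ctx t ω 0 - B.ctx t ω 1) (B.estimate est t ω - B.param)
      -- The arithmetic-geometric mean inequality, balanced at `|D| = 2q`, the root mean square
      -- allowed by `hh_le`.
      have : |D| ≤ q + D ^ 2 / (4 * q) := by
        rw [← sub_nonneg]
        have e : q + D ^ 2 / (4 * q) - |D| = (2 * q - |D|) ^ 2 / (4 * q) := by
          rw [← sq_abs D]; field_simp; ring
        rw [e]; positivity
      calc κ₁ * |D| ≤ κ₁ * (q + D ^ 2 / (4 * q)) := by gcongr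
        _ = _ := by ring
  exact integral_le_of_le_indicator_add (hR.integrable_instantRegret hB hest hκ₀ hxmax t)
    (B.instantRegret_nonneg est t) hbad (by positivity) hκ₁ hq
    (hh.comp ((he.mono (hB.past_le t) le_rfl).prodMk (hB.measurable_ctx t))) hh_le hpt

/-- The compatibility constant is at most `√s₀ x_max`. -/
theorem compatibility_const_le (hR : B.Regular P xmax b κ₀ κ₁ φ₀ ν) (hB : B.IsModel P σ)
    (hxmax : 0 < xmax) (hs : 1 ≤ sparsity B.param) : φ₀ ≤ √(sparsity B.param) * xmax := by
  have := hB.isProbabilityMeasure_law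
  have hK := hB.ae_law (hR.norm_ctx_le 0)
  -- Compatibility is tested on a coordinate vector `e_j` with `j` active: its norms on the active
  -- set and off it are `1` and `0`, and `Σ_jj ≤ xmax²`.
  obtain ⟨j, hj⟩ := Finset.card_pos.1 (Nat.lt_of_lt_of_le Nat.zero_lt_one hs)
  have h1 : l1On (activeSet B.param) (EuclideanSpace.single j (1 : ℝ)) = 1 := by
    rw [l1On, Finset.sum_eq_single_of_mem j hj]
    · simp
    · intro k _ hk; simp [hk]
  have h2 : l1On (activeSet B.param)ᶜ (EuclideanSpace.single j (1 : ℝ)) = 0 := by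
    refine Finset.sum_eq_zero fun k hk => ?_
    have : k ≠ j := fun h => Finset.mem_compl.1 hk (h ▸ hj)
    simp [this]
  have hc := hR.compatibility (EuclideanSpace.single j (1 : ℝ)) (by rw [h1, h2]; norm_num)
  rw [h1, dotProduct_gramMatrix_mulVec hK] at hc
  have h3 : ∀ i : Fin 2, ∫ x, inner ℝ (x i) (EuclideanSpace.single j (1 : ℝ)) ^ 2 ∂B.law ≤
      xmax ^ 2 := by
    intro i
    have := integral_mono_of_nonneg (μ := B.law) (f := fun x : Contexts d =>
      inner ℝ (x i) (EuclideanSpace.single j (1 : ℝ)) ^ 2) (g := fun _ => xmax ^ 2)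
      (ae_of_all _ fun x => sq_nonneg _) (integrable_const _) (hK.mono fun x hx => by
        have := abs_mul_apply_le_sq (hx i) j j
        rw [← sq, abs_of_nonneg (sq_nonneg _)] at this
        simpa [EuclideanSpace.inner_single_right] using this)
    simpa using this
  rw [Fin.sum_univ_two] at hc
  have hs0 : (0 : ℝ) ≤ sparsity B.param := Nat.cast_nonneg _
  refine le_of_sq_le_sq ?_ (by positivity)
  rw [mul_pow, Real.sq_sqrt hs0]
  have h4 := mul_le_mul_of_nonneg_left (add_le_add (h3 0) (h3 1)) hs0
  have hc' : φ₀ ^ 2 * 1 ^ 2 ≤ (sparsity B.param : ℝ) * (1 / 2 *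
    (∫ x, inner ℝ (x 0) (EuclideanSpace.single j (1 : ℝ)) ^ 2 ∂B.law +
      ∫ x, inner ℝ (x 1) (EuclideanSpace.single j (1 : ℝ)) ^ 2 ∂B.law)) := hc
  linarith

end GLMBandit.Regular

/-! ### Summation over the rounds -/

theorem sum_inv_sqrt_le (T : ℕ) : ∑ t ∈ Finset.range T, 1 / √(t : ℝ) ≤ 2 * √T := by
  -- The term `t = 0` is `1 / 0 = 0`, so the sum effectively starts at `t = 1`; each later term is
  -- at most `2 (√(n+1) - √n)`.
  have h : ∀ n : ℕ, ∑ t ∈ Finset.range (n + 1), 1 / √(t : ℝ) ≤ 2 * √n := by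
    intro n
    induction n with
    | zero => simp
    | succ n ih =>
      rw [Finset.sum_range_succ]
      have h1 : 0 < √((n + 1 : ℕ) : ℝ) := Real.sqrt_pos.2 (by positivity)
      have h2 := Real.sq_sqrt (Nat.cast_nonneg (α := ℝ) (n + 1))
      have h3 := Real.sq_sqrt (Nat.cast_nonneg (α := ℝ) n)
      have h4 := Real.sqrt_nonneg (n : ℝ)
      push_cast at h1 h2 ih ⊢
      have h5 : 1 / √((n : ℝ) + 1) ≤ 2 * (√((n : ℝ) + 1) - √n) := by
        rw [div_le_iff₀ h1]
        nlinarith [sq_nonneg (√((n : ℝ) + 1) - √n)]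
      linarith
  rcases T with _ | n
  · simp
  · refine (h n).trans ?_
    gcongr
    exact n.le_succ

/-- Two rounds receive the trivial bound `1`; the tail telescopes through `2/(n+1) - 2/(n+2)`. -/
theorem sum_two_div_sq_le (T : ℕ) :
    ∑ t ∈ Finset.range T, (if t < 2 then (1 : ℝ) else 2 / (t : ℝ) ^ 2) ≤ 4 := by
  have h : ∀ n : ℕ, ∑ t ∈ Finset.range (n + 2), (if t < 2 then (1 : ℝ) else 2 / (t : ℝ) ^ 2) ≤
      4 - 2 / (n + 1) := by
    intro n
    induction n with
    | zero => norm_num [Finset.sum_range_succ]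
    | succ n ih =>
      rw [show n + 1 + 2 = (n + 2) + 1 by ring, Finset.sum_range_succ, if_neg (by omega)]
      push_cast
      have h1 : 2 / ((n : ℝ) + 2) ^ 2 ≤ 2 / (n + 1) - 2 / (n + 1 + 1) := by
        rw [div_sub_div _ _ (by positivity) (by positivity), div_le_div_iff₀ (by positivity)
          (by positivity)]
        have : (0 : ℝ) ≤ n := Nat.cast_nonneg n
        nlinarith
      linarith
  calc _ ≤ ∑ t ∈ Finset.range (T + 2), (if t < 2 then (1 : ℝ) else 2 / (t : ℝ) ^ 2) := by
        refine Finset.sum_le_sum_of_subset_of_nonneg (Finset.range_subset_range.2 (by omega)) ?_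
        intro t _ _
        split_ifs <;> positivity
    _ ≤ _ := h T
    _ ≤ 4 := sub_le_self _ (by positivity)

theorem sum_exp_neg_mul_le {a : ℝ} (ha : 0 < a) (T : ℕ) :
    ∑ t ∈ Finset.range T, Real.exp (-(a * t)) ≤ 1 + 1 / a := by
  have h1 : ∀ t : ℕ, Real.exp (-(a * t)) = Real.exp (-a) ^ t := fun t => by
    rw [← Real.exp_nat_mul]; ring_nf
  simp only [h1]
  have h2 := geom_sum_mul_neg (Real.exp (-a)) T
  have h3 : Real.exp (-a) ≤ 1 / (1 + a) := by
    rw [Real.exp_neg, ← one_div]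
    exact one_div_le_one_div_of_le (by positivity) (by linarith [Real.add_one_le_exp a])
  have h4 : a / (1 + a) ≤ 1 - Real.exp (-a) := by
    have : a / (1 + a) = 1 - 1 / (1 + a) := by field_simp; ring
    linarith
  have h5 : 0 ≤ ∑ t ∈ Finset.range T, Real.exp (-a) ^ t := by positivity
  have h6 : (∑ t ∈ Finset.range T, Real.exp (-a) ^ t) * (a / (1 + a)) ≤ 1 := by
    have := mul_le_mul_of_nonneg_left h4 h5
    have : 0 ≤ Real.exp (-a) ^ T := by positivity
    linarith
  rw [← le_div_iff₀ (by positivity)] at h6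
  refine h6.trans_eq ?_
  field_simp
  ring

theorem sum_min_one_mul_exp_le {a A : ℝ} (ha : 0 < a) (hA : 1 ≤ A) (T : ℕ) :
    ∑ t ∈ Finset.range T, min 1 (A * Real.exp (-(a * t))) ≤ 2 + (Real.log A + 1) / a := by
  -- Before `N` the bound `1` is used; from `N` on, the factor `A` has been absorbed and a geometric
  -- series remains.
  set N := ⌈Real.log A / a⌉₊ with hN
  have hA0 : 0 < A := by linarith
  have hN1 : (N : ℝ) ≤ Real.log A / a + 1 :=
    (Nat.ceil_lt_add_one (div_nonneg (Real.log_nonneg hA) ha.le)).le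
  have hN2 : A * Real.exp (-(a * N)) ≤ 1 := by
    have h := Nat.le_ceil (Real.log A / a)
    rw [← hN, div_le_iff₀ ha] at h
    calc A * Real.exp (-(a * N)) ≤ A * Real.exp (-Real.log A) := by gcongr; linarith
      _ = 1 := by rw [Real.exp_neg, Real.exp_log hA0]; exact mul_inv_cancel₀ hA0.ne'
  calc _ ≤ ∑ t ∈ Finset.range (N + T), min 1 (A * Real.exp (-(a * t))) :=
        Finset.sum_le_sum_of_subset_of_nonneg (Finset.range_subset_range.2 (by omega))
          fun t _ _ => le_min zero_le_one (by positivity)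
    _ = ∑ t ∈ Finset.range N, min 1 (A * Real.exp (-(a * t))) +
          ∑ t ∈ Finset.range T, min 1 (A * Real.exp (-(a * (N + t : ℕ)))) :=
        Finset.sum_range_add _ _ _
    _ ≤ ∑ _t ∈ Finset.range N, 1 + ∑ t ∈ Finset.range T, Real.exp (-(a * t)) := by
        refine add_le_add (Finset.sum_le_sum fun t _ => min_le_left _ _)
          (Finset.sum_le_sum fun t _ => (min_le_right _ _).trans ?_)
        have e : A * Real.exp (-(a * (N + t : ℕ))) =
            A * Real.exp (-(a * N)) * Real.exp (-(a * t)) := by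
          rw [mul_assoc, ← Real.exp_add]; push_cast; ring_nf
        rw [e]
        exact mul_le_of_le_one_left (Real.exp_pos _).le hN2
    _ ≤ (Real.log A / a + 1) + (1 + 1 / a) := by
        refine add_le_add ?_ (sum_exp_neg_mul_le ha T)
        simpa using hN1
    _ = _ := by ring

namespace GLMBandit.Regular

variable {d : ℕ} {Ω : Type*} [mΩ : MeasurableSpace Ω] {P : Measure Ω}
  {B : GLMBandit d Ω} {est : (n : ℕ) → (Fin n → Vec d × ℝ) → Vec d}
  {σ xmax b κ₀ κ₁ φ₀ ν : ℝ}

theorem regret_eq_zero (hR : B.Regular P xmax b κ₀ κ₁ φ₀ ν) (hκ₀ : 0 < κ₀)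
    (hs : sparsity B.param = 0) (T : ℕ) : B.regret P est T = 0 := by
  have hp : B.param = 0 := by
    ext j
    by_contra hj
    have : j ∈ activeSet B.param := by simpa [activeSet] using hj
    rw [Finset.card_eq_zero.1 hs] at this
    simp at this
  refine Finset.sum_eq_zero fun t _ => ?_
  have : ∀ ω, B.instantRegret est t ω = 0 := fun ω => by
    refine le_antisymm ?_ (B.instantRegret_nonneg est t ω)
    have := hR.instantRegret_le_param (est := est) hκ₀ t ω
    simpa [hp] using this
  simp [this]

variable [IsProbabilityMeasure P]

theorem regret_le_mul (hR : B.Regular P xmax b κ₀ κ₁ φ₀ ν) (hB : B.IsModel P σ)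
    (hest : ∀ n, Measurable (est n)) (hκ₀ : 0 < κ₀) (hxmax : 0 < xmax) (T : ℕ) :
    B.regret P est T ≤ 2 * κ₁ * xmax * b * T := by
  refine (Finset.sum_le_sum fun t _ =>
    hR.integral_instantRegret_le_const hB hest hκ₀ hxmax t).trans_eq ?_
  rw [Finset.sum_const, Finset.card_range, nsmul_eq_mul, mul_comm]

theorem two_mul_kappa_mul_le (hR : B.Regular P xmax b κ₀ κ₁ φ₀ ν) (hB : B.IsModel P σ)
    (hκ₀ : 0 < κ₀) (hσ : 0 < σ) (hxmax : 0 < xmax) (hφ₀ : 0 < φ₀) (hs : 1 ≤ sparsity B.param)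
    (hd : 1 ≤ d) {t T : ℕ} (ht : 2 ≤ t) (htT : t ≤ T) :
    2 * κ₁ * (2 * ν * regParam (2 * σ * xmax) d t * √(sparsity B.param) / (κ₀ * φ₀)) ≤
      16 * κ₁ * ν * σ * xmax ^ 2 * sparsity B.param / (κ₀ * φ₀ ^ 2) *
        √(Real.log (d * T)) * (1 / √(t : ℝ)) := by
  have := hB.isProbabilityMeasure_law
  have hκ₁ := hR.kappa_one_nonneg hκ₀
  have hν : 0 < ν := zero_lt_one.trans_le (B.one_le_of_relaxed_symmetry hR.relaxed_symmetry)
  have hφ := hR.compatibility_const_le hB hxmax hs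
  have ht0 : (0 : ℝ) < t := by positivity
  have hd0 : (0 : ℝ) < d := by exact_mod_cast hd
  have hT0 : (0 : ℝ) < T := ht0.trans_le (by exact_mod_cast htT)
  have hlog : √((4 * Real.log t + 2 * Real.log d) / t) ≤ 2 * √(Real.log (d * T)) * (1 / √t) := by
    have h1 : 4 * Real.log t + 2 * Real.log d ≤ 2 ^ 2 * Real.log (d * T) := by
      rw [Real.log_mul hd0.ne' hT0.ne']
      have : Real.log t ≤ Real.log T := Real.log_le_log ht0 (by exact_mod_cast htT)
      have := Real.log_natCast_nonneg d
      linarith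
    rw [Real.sqrt_div' _ ht0.le, div_eq_mul_one_div]
    gcongr
    calc _ ≤ √(2 ^ 2 * Real.log (d * T)) := Real.sqrt_le_sqrt h1
      _ = _ := by rw [Real.sqrt_mul (by positivity), Real.sqrt_sq (by positivity)]
  set s : ℝ := (sparsity B.param : ℝ)
  have hs0 : 0 ≤ s := Nat.cast_nonneg _
  have hss : √s * √s = s := Real.mul_self_sqrt hs0
  have hreg0 : 0 ≤ regParam (2 * σ * xmax) d t := (regParam_pos (by positivity) ht).le
  calc 2 * κ₁ * (2 * ν * regParam (2 * σ * xmax) d t * √s / (κ₀ * φ₀))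
      = 4 * κ₁ * ν * regParam (2 * σ * xmax) d t * √s * φ₀ / (κ₀ * φ₀ ^ 2) := by
        field_simp; ring
    -- The natural rate has `√s₀ / φ₀`. It is weakened to `s₀ xmax / φ₀²` through `φ₀ ≤ √s₀ xmax`,
    -- which accounts for the second factor `xmax` in the theorem.
    _ ≤ 4 * κ₁ * ν * regParam (2 * σ * xmax) d t * √s * (√s * xmax) / (κ₀ * φ₀ ^ 2) := by
        gcongr
    _ = 4 * κ₁ * ν * xmax * s / (κ₀ * φ₀ ^ 2) * regParam (2 * σ * xmax) d t := by
        linear_combination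
          4 * κ₁ * ν * xmax / (κ₀ * φ₀ ^ 2) * regParam (2 * σ * xmax) d t * hss
    _ ≤ 4 * κ₁ * ν * xmax * s / (κ₀ * φ₀ ^ 2) *
          (2 * σ * xmax * (2 * √(Real.log (d * T)) * (1 / √t))) := by
        unfold regParam
        gcongr
    _ = _ := by ring

theorem regret_le (hR : B.Regular P xmax b κ₀ κ₁ φ₀ ν) (hB : B.IsModel P σ)
    (hE : IsLassoEstimator B.cumulant (2 * σ * xmax) est) (hκ₀ : 0 < κ₀) (hσ : 0 < σ)
    (hxmax : 0 < xmax) (hφ₀ : 0 < φ₀) (hb : 0 < b) (hs : 1 ≤ sparsity B.param) (hd : 1 ≤ d)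
    (T : ℕ) :
    B.regret P est T ≤
      4 * κ₁ * xmax * b * (Real.log (2 * d ^ 2) + 1) / C0 φ₀ ν xmax (sparsity B.param) ^ 2
      + 32 * κ₁ * ν * σ * xmax ^ 2 * sparsity B.param * √(T * Real.log (d * T))
          / (κ₀ * φ₀ ^ 2) := by
  have := hB.isProbabilityMeasure_law
  have hest := hE.measurable
  have hκ₁ := hR.kappa_one_nonneg hκ₀
  have hν : 0 < ν := zero_lt_one.trans_le (B.one_le_of_relaxed_symmetry hR.relaxed_symmetry)
  have hd1 : (1 : ℝ) ≤ d := by exact_mod_cast hd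
  have hs1 : (1 : ℝ) ≤ sparsity B.param := by exact_mod_cast hs
  set c := C0 φ₀ ν xmax (sparsity B.param)
  have hc0 : 0 < c := lt_min (by norm_num) (by positivity)
  have hc1 : c ≤ 1 / 2 := min_le_left _ _
  set W := 16 * κ₁ * ν * σ * xmax ^ 2 * sparsity B.param / (κ₀ * φ₀ ^ 2) with hW
  have hW0 : 0 ≤ W := by positivity
  have hA : (1 : ℝ) ≤ 2 * d ^ 2 := by nlinarith
  set A : ℝ := 2 * d ^ 2
  set L := √(Real.log (d * T)) with hL
  have hround : ∀ t ∈ Finset.range T, ∫ ω, B.instantRegret est t ω ∂P ≤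
      2 * κ₁ * xmax * b * ((if t < 2 then (1 : ℝ) else 2 / (t : ℝ) ^ 2) +
        min 1 (A * Real.exp (-(8 * c ^ 2 * t)))) + W * L * (1 / √(t : ℝ)) := by
    intro t ht
    have hm : 0 ≤ min 1 (A * Real.exp (-(8 * c ^ 2 * t))) := le_min zero_le_one (by positivity)
    have hr : 0 ≤ W * L * (1 / √(t : ℝ)) := by positivity
    have hk : 0 ≤ 2 * κ₁ * xmax * b := by positivity
    -- With zero-based rounds the estimate in round `t` uses `t` observations: for `t = 0` it is
    -- arbitrary, and for `t = 1` and `d = 1` the penalty is zero.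
    by_cases h2 : t < 2
    · rw [if_pos h2]
      refine (hR.integral_instantRegret_le_const hB hest hκ₀ hxmax t).trans ?_
      nlinarith
    · rw [if_neg h2]
      have h2 : 2 ≤ t := not_lt.1 h2
      have hreg := regParam_pos (lam0 := 2 * σ * xmax) (by positivity) (d := d) h2
      refine (hR.integral_instantRegret_le hB hest hκ₀ hxmax hb t
        (q := 2 * ν * regParam (2 * σ * xmax) d t * √(sparsity B.param) / (κ₀ * φ₀))
        (by positivity)).trans ?_
      refine add_le_add (mul_le_mul_of_nonneg_left ?_ hk)
        (hR.two_mul_kappa_mul_le hB hκ₀ hσ hxmax hφ₀ hs hd h2 (Finset.mem_range.1 ht).le)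
      have hq : (2 * ν * regParam (2 * σ * xmax) d t * √(sparsity B.param) / (κ₀ * φ₀)) ^ 2 =
          4 * ν ^ 2 * regParam (2 * σ * xmax) d t ^ 2 * sparsity B.param / (κ₀ ^ 2 * φ₀ ^ 2) := by
        rw [div_pow, mul_pow, Real.sq_sqrt (by positivity)]
        ring
      rw [hq]
      have h3 := hR.measureReal_predError_gt_le hB hE hσ hxmax hκ₀ hφ₀ hs hd h2
      rw [← min_add_add_left]
      refine le_min (measureReal_le_one.trans ?_) h3
      exact le_add_of_nonneg_left (by positivity)
  have hsum1 : ∑ t ∈ Finset.range T, ((if t < 2 then (1 : ℝ) else 2 / (t : ℝ) ^ 2) +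
      min 1 (A * Real.exp (-(8 * c ^ 2 * t)))) ≤ 2 * (Real.log A + 1) / c ^ 2 := by
    rw [Finset.sum_add_distrib]
    refine (add_le_add (sum_two_div_sq_le T)
      (sum_min_one_mul_exp_le (a := 8 * c ^ 2) (by positivity) hA T)).trans ?_
    have hlog : 0 ≤ Real.log A := Real.log_nonneg hA
    have hc2 : c ^ 2 ≤ 1 / 4 := by nlinarith
    rw [le_div_iff₀ (by positivity)]
    have e : (4 + (2 + (Real.log A + 1) / (8 * c ^ 2))) * c ^ 2 =
        6 * c ^ 2 + (Real.log A + 1) / 8 := by field_simp; ring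
    rw [e]
    linarith
  calc B.regret P est T ≤ _ := Finset.sum_le_sum hround
    _ = 2 * κ₁ * xmax * b * ∑ t ∈ Finset.range T, ((if t < 2 then (1 : ℝ) else 2 / (t : ℝ) ^ 2) +
          min 1 (A * Real.exp (-(8 * c ^ 2 * t)))) +
          W * L * ∑ t ∈ Finset.range T, 1 / √(t : ℝ) := by
        rw [Finset.sum_add_distrib, Finset.mul_sum, Finset.mul_sum]
    _ ≤ 2 * κ₁ * xmax * b * (2 * (Real.log A + 1) / c ^ 2) + W * L * (2 * √T) := by
        gcongr
        exact sum_inv_sqrt_le T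
    _ = _ := by
        rw [Real.sqrt_mul (Nat.cast_nonneg T), ← hL, hW]
        ring

/-- The order of growth of the regret, uniformly in the dimension. -/
theorem regret_le_order (hR : B.Regular P xmax b κ₀ κ₁ φ₀ ν) (hB : B.IsModel P σ)
    (hE : IsLassoEstimator B.cumulant (2 * σ * xmax) est) (hκ₀ : 0 < κ₀) (hσ : 0 < σ)
    (hxmax : 0 < xmax) (hφ₀ : 0 < φ₀) (hb : 0 < b) (hs : 1 ≤ sparsity B.param) (hd : 1 ≤ d)
    {T : ℕ} (hT : 1 ≤ T) (hdT : 2 ≤ d * T) :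
    B.regret P est T ≤
      (2 * κ₁ * xmax * b + 20 * κ₁ * xmax * b * (2 + 256 * ν * xmax ^ 2 / φ₀ ^ 2) ^ 2 +
        32 * κ₁ * ν * σ * xmax ^ 2 / (κ₀ * φ₀ ^ 2)) *
        (sparsity B.param * √(T * Real.log (d * T))) := by
  have := hB.isProbabilityMeasure_law
  have hκ₁ := hR.kappa_one_nonneg hκ₀
  have hν : 0 < ν := zero_lt_one.trans_le (B.one_le_of_relaxed_symmetry hR.relaxed_symmetry)
  have h1 := hR.regret_le_mul hB hE.measurable hκ₀ hxmax T
  have h2 := hR.regret_le hB hE hκ₀ hσ hxmax hφ₀ hb hs hd T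
  have hs1 : (1 : ℝ) ≤ sparsity B.param := by exact_mod_cast hs
  have hd1 : (1 : ℝ) ≤ d := by exact_mod_cast hd
  have hT1 : (1 : ℝ) ≤ T := by exact_mod_cast hT
  have hdT2 : (2 : ℝ) ≤ d * T := by exact_mod_cast hdT
  set s : ℝ := (sparsity B.param : ℝ)
  -- The denominator is the sum of the reciprocals of the two entries of `C0`, up to a factor `s`,
  -- so that `C0 ≥ 1 / (s g)`.
  set g : ℝ := 2 + 256 * ν * xmax ^ 2 / φ₀ ^ 2 with hg
  have hg0 : 0 < g := by positivity
  set L := Real.log (d * T)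
  have hlog2 : Real.log 2 ≤ L := Real.log_le_log two_pos hdT2
  have hhalf : 1 / 2 < Real.log 2 := by linarith [Real.log_two_gt_d9]
  have hL0 : 0 < L := by linarith
  have hlogd : Real.log d ≤ L := Real.log_le_log (by linarith) (by nlinarith)
  -- Here `dT ≥ 2` enters: `1 < 2 log 2 ≤ 2L`, while `log 2 ≤ L` and `2 log d ≤ 2L`.
  have hA : Real.log (2 * d ^ 2) + 1 ≤ 5 * L := by
    rw [Real.log_mul two_ne_zero (by positivity), Real.log_pow]
    push_cast
    linarith
  have hC : 1 / (s * g) ≤ C0 φ₀ ν xmax (sparsity B.param) := by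
    refine le_min ?_ ?_
    · refine one_div_le_one_div_of_le two_pos ?_
      have : 0 ≤ 256 * ν * xmax ^ 2 / φ₀ ^ 2 := by positivity
      nlinarith
    · rw [div_le_div_iff₀ (by positivity) (by positivity), hg]
      have e : φ₀ ^ 2 * (s * (2 + 256 * ν * xmax ^ 2 / φ₀ ^ 2)) =
          2 * φ₀ ^ 2 * s + 256 * s * ν * xmax ^ 2 := by field_simp
      rw [e, one_mul]
      exact le_add_of_nonneg_left (by positivity)
  have hmid : 4 * κ₁ * xmax * b * (Real.log (2 * d ^ 2) + 1) /
      C0 φ₀ ν xmax (sparsity B.param) ^ 2 ≤ 20 * κ₁ * xmax * b * g ^ 2 * (s ^ 2 * L) := by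
    calc _ ≤ 4 * κ₁ * xmax * b * (5 * L) / (1 / (s * g)) ^ 2 := by gcongr
      _ = _ := by field_simp; ring
  have hsq : √(T * L) = √T * √L := Real.sqrt_mul (by positivity) _
  have hTT : √(T : ℝ) * √T = T := Real.mul_self_sqrt (by positivity)
  have hLL : √L * √L = L := Real.mul_self_sqrt hL0.le
  have hX : 0 ≤ s * √(T * L) := by positivity
  -- For short horizons `T ≤ s √(TL)` makes the trivial bound enough; for long ones `s² L ≤ s √(TL)`
  -- absorbs the middle term.
  rcases le_total (√(T : ℝ)) (s * √L) with hle | hle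
  · have h3 : (T : ℝ) ≤ s * √(T * L) := by
      calc (T : ℝ) = √T * √T := hTT.symm
        _ ≤ √T * (s * √L) := by gcongr
        _ = _ := by rw [hsq]; ring
    refine h1.trans ((mul_le_mul_of_nonneg_left h3 (by positivity)).trans ?_)
    refine mul_le_mul_of_nonneg_right ?_ hX
    rw [add_assoc]
    exact le_add_of_nonneg_right (by positivity)
  · have h3 : s ^ 2 * L ≤ s * √(T * L) := by
      calc s ^ 2 * L = s * √L * (s * √L) := by linear_combination -s ^ 2 * hLL
        _ ≤ s * √L * √T := by gcongr
        _ = _ := by rw [hsq]; ring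
    have h4 := mul_le_mul_of_nonneg_left h3
      (show 0 ≤ 20 * κ₁ * xmax * b * g ^ 2 by positivity)
    have h5 : 0 ≤ 2 * κ₁ * xmax * b * (s * √(T * L)) := by positivity
    calc _ ≤ _ := h2
      _ ≤ 2 * κ₁ * xmax * b * (s * √(T * L)) + 20 * κ₁ * xmax * b * g ^ 2 * (s * √(T * L)) +
          32 * κ₁ * ν * σ * xmax ^ 2 * s * √(T * L) / (κ₀ * φ₀ ^ 2) := by linarith
      _ = _ := by ring

end GLMBandit.Regular

/-! ### The main theorem -/

theorem log_two_mul_sq_add_one_nonneg (d : ℕ) : 0 ≤ Real.log (2 * (d : ℝ) ^ 2) + 1 := by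
  rcases Nat.eq_zero_or_pos d with rfl | hd
  · simp
  · have : (1 : ℝ) ≤ d := by exact_mod_cast hd
    have := Real.log_nonneg (show (1 : ℝ) ≤ 2 * (d : ℝ) ^ 2 by nlinarith)
    linarith

theorem theorem1 (κ₀ κ₁ ν σ xmax φ₀ b : ℝ)
    (hκ₀ : 0 < κ₀) (hσ : 0 < σ) (hxmax : 0 < xmax) (hφ₀ : 0 < φ₀) (hb : 0 < b) :
    ∃ C : ℝ, ∀ (d : ℕ) (Ω : Type*) [MeasurableSpace Ω] (P : Measure Ω) [IsProbabilityMeasure P]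
      (B : GLMBandit d Ω) (est : (n : ℕ) → (Fin n → Vec d × ℝ) → Vec d),
      B.IsModel P σ →
      B.Regular P xmax b κ₀ κ₁ φ₀ ν →
      IsLassoEstimator B.cumulant (2 * σ * xmax) est →
      (∀ t, Integrable (B.instantRegret est t) P) ∧
      ∀ T : ℕ, 1 ≤ T →
        -- the bound for arbitrary `xmax`
        B.regret P est T ≤
          4 * κ₁
          + 4 * κ₁ * xmax * b * (Real.log (2 * d ^ 2) + 1) / C0 φ₀ ν xmax (sparsity B.param) ^ 2
          + 32 * κ₁ * ν * σ * xmax ^ 2 * sparsity B.param * √(T * Real.log (d * T))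
              / (κ₀ * φ₀ ^ 2) ∧
        -- the bound for features of norm at most one
        (xmax ≤ 1 → B.regret P est T ≤
          4 * κ₁
          + 4 * κ₁ * xmax * b * (Real.log (2 * d ^ 2) + 1) / C0 φ₀ ν xmax (sparsity B.param) ^ 2
          + 32 * κ₁ * ν * σ * xmax * sparsity B.param * √(T * Real.log (d * T))
              / (κ₀ * φ₀ ^ 2)) ∧
        -- the order of growth, uniformly in the dimension, the sparsity and the horizon
        (2 ≤ d * T → B.regret P est T ≤ C * (sparsity B.param * √(T * Real.log (d * T)))) := by
  refine ⟨2 * κ₁ * xmax * b + 20 * κ₁ * xmax * b * (2 + 256 * ν * xmax ^ 2 / φ₀ ^ 2) ^ 2 +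
    32 * κ₁ * ν * σ * xmax ^ 2 / (κ₀ * φ₀ ^ 2), ?_⟩
  intro d Ω _ P _ B est hB hR hE
  refine ⟨hR.integrable_instantRegret hB hE.measurable hκ₀ hxmax, fun T hT => ?_⟩
  have := hB.isProbabilityMeasure_law
  have hκ₁ := hR.kappa_one_nonneg hκ₀
  have hν : 0 < ν := zero_lt_one.trans_le (B.one_le_of_relaxed_symmetry hR.relaxed_symmetry)
  have hlog := log_two_mul_sq_add_one_nonneg d
  have hmain : B.regret P est T ≤
      4 * κ₁
      + 4 * κ₁ * xmax * b * (Real.log (2 * d ^ 2) + 1) / C0 φ₀ ν xmax (sparsity B.param) ^ 2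
      + 32 * κ₁ * ν * σ * xmax ^ 2 * sparsity B.param * √(T * Real.log (d * T))
          / (κ₀ * φ₀ ^ 2) := by
    -- For `s₀ = 0` division by zero makes `C0 = 0` and the middle quotient `0`; the regret vanishes
    -- and only nonnegativity of the right side matters.
    rcases Nat.eq_zero_or_pos (sparsity B.param) with hs | hs
    · rw [hR.regret_eq_zero hκ₀ hs]
      positivity
    · have hd : 1 ≤ d := hs.trans_le ((Finset.card_le_univ _).trans_eq (Fintype.card_fin d))
      -- The first rounds are already covered by the middle term, so `4 κ₁ ≥ 0` is pure slack.
      have := hR.regret_le hB hE hκ₀ hσ hxmax hφ₀ hb hs hd T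
      linarith
  refine ⟨hmain, fun hx => hmain.trans ?_, fun hdT => ?_⟩
  · have : xmax ^ 2 ≤ xmax := by nlinarith
    gcongr
  · rcases Nat.eq_zero_or_pos (sparsity B.param) with hs | hs
    · rw [hR.regret_eq_zero hκ₀ hs, hs]
      simp
    · have hd : 1 ≤ d := hs.trans_le ((Finset.card_le_univ _).trans_eq (Fintype.card_fin d))
      exact hR.regret_le_order hB hE hκ₀ hσ hxmax hφ₀ hb hs hd hT hdT
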